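/- **Input.** Let $K$ be a finite, connected, pure polyhedral 3-complex in $\mathbb R^3$: its cells are points, straight segments, planar polygons and polyhedra homeomorphic to a ball (not necessarily convex), every face of a cell is a cell, and the nonempty intersection of two cells is a face of both. Let finitely many holes $\mathcal C^H$ (polyhedral balls bounded by polygons of $K$) and one outside region $\mathcal C^O$ (a closed region with connected interior, bounded by polygons of $K$) be given, whose interiors are disjoint from $|K|$. The boundary of each 3-cell, hole and of the outside is a closed surface: each of its edges lies in exactly two of its facets. Assume that $|K|\cup|\mathcal C^H|\cup|\mathcal C^O|=\mathbb R^3$; that the holes are pairwise disjoint and disjoint from the outside; that a 3-cell of $K$ and a hole share at most one facet; that no two adjacent facets of a 3-cell of $K$ are both facets of the outside; and that every vertex of a 3-cell $t$ of $K$ has degree $3$ in the 1-skeleton of $t$. Call the 3-cells of $K$, the holes and the outside *regions*. **Euler transformation.** The abstract 3-complex $\hat K$ has: a vertex $\hat v_r$ for each vertex $v$ of a region $r$; an edge $\hat e_r$ (joining the $\hat v_r$, $v\in e$) for each edge $e$ of a region $r$, and an edge joining $\hat v_r$ and $\hat v_{r'}$ for each vertex $v$ of a polygon $f$ of $K$,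 where $r,r'$ are the two regions with facet $f$; a polygon $\hat f_r$ with edges $\hat e_r$ ($e\subset f$) for each facet $f$ of a region $r$; a 4-gon with vertices $\hat u_r,\hat v_r,\hat v_{r'},\hat u_{r'}$ for each edge $e=\{u,v\}$ of a polygon $f$, with $r,r'$ as before; a polygon with vertices $\hat v_r$, $r\supset e$, for each endpoint $v$ of an edge $e$, consecutive vertices belonging to regions that share a polygon containing $e$; and 3-cells, one for each 3-cell $t$ of $K$ (facets $\hat f_t$), each polygon $f$ (facets: the two copies of $f$ and the 4-gons of the edges of $f$), each edge $e$ (facets: the 4-gons of $e$ and the two polygons of the endpoints of $e$), and each vertex $v$ (facets: the polygons of the edges at $v$; if the 3-cells of $K$ at $v$ fall into several components under sharing a polygon at $v$, one 3-cell for each component). Let $\hat K$ be geometrically realized in $\mathbb R^3$: edges are straight segments; a 2-cell is a disc bounded by its edges, either a planar polygon or a non-planar disc triangulated by finitely many straight triangles; a 3-cell is homeomorphic to a ball and is bounded by its facets; the nonempty intersection of two cells is a face of both. **Claim.** Let $\mathcal P\subset\mathbb R^3$ be a plane that contains no cell of $\hat K$ (in particular no vertex) and no simplex of the triangulations of its non-planar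 2-cells. Let the vertices of the slice $\mathcal P\cap\hat K$ be the points in which $\mathcal P$ meets edges of $\hat K$, and its edges the connected components of the sets $\mathcal P\cap\hat f$, $\hat f$ a 2-cell of $\hat K$. Then every edge of the slice that contains a vertex contains exactly two vertices, and the 1-skeleton of $\mathcal P\cap\hat K$ is Eulerian with all degrees $4$: every vertex of the slice lies on exactly four edges and has exactly four neighbours, and every connected component of the 1-skeleton has an Eulerian circuit. -/

import Mathlib

/-- Euclidean 3-space. -/
abbrev E3 : Type := EuclideanSpace ℝ (Fin 3)

/-- The combinatorial data of a cell complex of dimension at most three: vertices, edges, polygons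
and 3-cells, every cell of positive dimension being specified by the list of its facets. -/
structure AbstractComplex where
  V : Type
  E : Type
  F : Type
  T : Type
  /-- the endpoints of an edge -/
  ends : E → Set V
  /-- the edges of a polygon -/
  sides : F → Set E
  /-- the polygonal facets of a 3-cell -/
  facets : T → Set F

namespace AbstractComplex

/-- The vertices of a polygon. -/
def corners (X : AbstractComplex) (f : X.F) : Set X.V :=
  {v | ∃ e ∈ X.sides f, v ∈ X.ends e}

/-- The cells of a complex. -/
inductive Cell (X : AbstractComplex) : Type
  | vertex (v : X.V)
  | edge (e : X.E)
  | polygon (f : X.F)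
  | solid (t : X.T)

/-- `c` is a facet of `d`. -/
inductive IsFacet (X : AbstractComplex) : X.Cell → X.Cell → Prop
  | vertex_edge {v : X.V} {e : X.E} (h : v ∈ X.ends e) : IsFacet X (.vertex v) (.edge e)
  | edge_polygon {e : X.E} {f : X.F} (h : e ∈ X.sides f) : IsFacet X (.edge e) (.polygon f)
  | polygon_solid {f : X.F} {t : X.T} (h : f ∈ X.facets t) : IsFacet X (.polygon f) (.solid t)

/-- `c` is a (possibly improper) face of `d`. -/
def IsFace (X : AbstractComplex) : X.Cell → X.Cell → Prop :=
  Relation.ReflTransGen X.IsFacet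

end AbstractComplex

/-- Point sets in 3-space for the cells of a complex: positions of the vertices, a simplicial complex
that triangulates each 2-cell, and the point set of each 3-cell. -/
structure CellBodies (X : AbstractComplex) where
  pos : X.V → E3
  disc : X.F → Geometry.SimplicialComplex ℝ E3
  solidBody : X.T → Set E3

namespace CellBodies

/-- The point set of a cell. Edges are straight line segments. -/
def body {X : AbstractComplex} (R : CellBodies X) : X.Cell → Set E3
  | .vertex v => {R.pos v}
  | .edge e => convexHull ℝ (R.pos '' X.ends e)
  | .polygon f => (R.disc f).space
  | .solid t => R.solidBody t

/-- The underlying space. -/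
def space {X : AbstractComplex} (R : CellBodies X) : Set E3 := ⋃ c, R.body c

end CellBodies

/-- A geometric realization of a complex in 3-space. Edges are straight. A 2-cell is a disc that is
a union of triangles and is bounded by the edges of the 2-cell; it may be non-planar, and the cells
need not be convex. A 3-cell is a ball bounded by its facets. The nonempty intersection of any two
cells is a face of both. -/
structure Realization (X : AbstractComplex) extends CellBodies X where
  disc_homeo : ∀ f, Nonempty
    ((disc f).space ≃ₜ Metric.closedBall (0 : EuclideanSpace ℝ (Fin 2)) 1)
  disc_finite : ∀ f, (disc f).faces.Finite
  /-- every simplex of the disc lies in a triangle of the disc -/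
  disc_pure : ∀ f, ∀ s ∈ (disc f).faces, ∃ t ∈ (disc f).faces, s ⊆ t ∧ t.card = 3
  /-- the edges of the 2-cell occur in the disc ... -/
  side_mem : ∀ f, ∀ e ∈ X.sides f, ∃ s ∈ (disc f).faces, (s : Set E3) = pos '' X.ends e
  /-- ... as its boundary edges: each lies in exactly one triangle, ... -/
  side_boundary : ∀ f, ∀ e ∈ X.sides f, ∀ s ∈ (disc f).faces, (s : Set E3) = pos '' X.ends e →
    {t ∈ (disc f).faces | t.card = 3 ∧ s ⊆ t}.ncard = 1
  /-- ... and the other edges of the disc are interior: each lies in exactly two triangles -/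
  inner_edge : ∀ f, ∀ s ∈ (disc f).faces, s.card = 2 →
    (∀ e ∈ X.sides f, (s : Set E3) ≠ pos '' X.ends e) →
    {t ∈ (disc f).faces | t.card = 3 ∧ s ⊆ t}.ncard = 2
  /-- a planar polygon is cut into triangles by diagonals, which is always possible, so that the
  triangulation of a planar 2-cell adds no vertices -/
  disc_planar : ∀ f, Coplanar ℝ (disc f).space →
    ∀ s ∈ (disc f).faces, (s : Set E3) ⊆ pos '' X.corners f
  solid_homeo : ∀ t, Nonempty (solidBody t ≃ₜ Metric.closedBall (0 : E3) 1)
  solid_regular : ∀ t, closure (interior (solidBody t)) = solidBody t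
  solid_frontier : ∀ t, frontier (solidBody t) = ⋃ f ∈ X.facets t, (disc f).space
  /-- the nonempty intersection of any two cells is a face of both -/
  inter_face : ∀ c d : X.Cell, (toCellBodies.body c ∩ toCellBodies.body d).Nonempty →
    ∃ b, X.IsFace b c ∧ X.IsFace b d ∧
      toCellBodies.body b = toCellBodies.body c ∩ toCellBodies.body d

/-- The combinatorial data of an input mesh: a complex `K`, a collection of holes and one outside
region, the holes and the outside being specified by their facets, which are polygons of `K`. -/
structure Mesh extends AbstractComplex where
  Hole : Type
  holeFacets : Hole → Set F
  outFacets : Set F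

namespace Mesh

/-- The 3-cells of `K`, the holes and the outside. -/
inductive Region (K : Mesh) : Type
  | cell (t : K.T)
  | hole (h : K.Hole)
  | outside

/-- The facets of a region. -/
def regionFacets (K : Mesh) : K.Region → Set K.F
  | .cell t => K.facets t
  | .hole h => K.holeFacets h
  | .outside => K.outFacets

/-- The edges of a region. -/
def regionEdges (K : Mesh) (r : K.Region) : Set K.E :=
  {e | ∃ f ∈ K.regionFacets r, e ∈ K.sides f}

/-- The vertices of a region. -/
def regionVertices (K : Mesh) (r : K.Region) : Set K.V :=
  {v | ∃ f ∈ K.regionFacets r, v ∈ K.corners f}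

end Mesh

/-- An input mesh in 3-space: a finite, connected, pure polyhedral 3-complex `K` with its holes and
its outside, subject to the standing assumptions on the input of the Euler transformation. -/
structure InputMesh (K : Mesh) extends Realization K.toAbstractComplex where
  holeBody : K.Hole → Set E3
  outBody : Set E3
  finite_V : Finite K.V
  finite_E : Finite K.E
  finite_F : Finite K.F
  finite_T : Finite K.T
  finite_Hole : Finite K.Hole
  /-- an edge has two endpoints -/
  ends_two : ∀ e, (K.ends e).ncard = 2
  /-- a polygon is planar -/
  planar : ∀ f, Coplanar ℝ (disc f).space
  /-- two sides of a polygon meet at each of its vertices -/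
  corner_two : ∀ f, ∀ v ∈ K.corners f, {e ∈ K.sides f | v ∈ K.ends e}.ncard = 2
  /-- the boundary of a polyhedron, also of a hole and of the outside, is a closed surface: two
  facets meet along each of its edges -/
  edge_two : ∀ r, ∀ e ∈ K.regionEdges r, {f ∈ K.regionFacets r | e ∈ K.sides f}.ncard = 2
  connected : IsConnected toCellBodies.space
  /-- purity: every cell is a face of a 3-cell -/
  pure : ∀ c, ∃ t, K.IsFace c (.solid t)
  /-- a hole is a ball bounded by polygons of `K`, and is not part of `K` -/
  hole_homeo : ∀ h, Nonempty (holeBody h ≃ₜ Metric.closedBall (0 : E3) 1)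
  hole_regular : ∀ h, closure (interior (holeBody h)) = holeBody h
  hole_frontier : ∀ h,
    frontier (holeBody h) = ⋃ f ∈ K.holeFacets h, (disc f).space
  hole_disjoint : ∀ h, Disjoint (interior (holeBody h)) toCellBodies.space
  /-- the outside is a connected closed region bounded by polygons of `K`, not part of `K` -/
  out_connected : IsConnected (interior outBody)
  out_regular : closure (interior outBody) = outBody
  out_frontier : frontier outBody = ⋃ f ∈ K.outFacets, (disc f).space
  out_disjoint : Disjoint (interior outBody) toCellBodies.space
  /-- the complex, the holes and the outside cover space -/
  cover : toCellBodies.space ∪ (⋃ h, holeBody h) ∪ outBody = Set.univ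
  /-- the holes are disjoint from each other and from the outside -/
  holes_disjoint : Pairwise fun h h' => Disjoint (holeBody h) (holeBody h')
  hole_out_disjoint : ∀ h, Disjoint (holeBody h) outBody
  /-- a 3-cell and a hole have at most one facet in common -/
  cell_hole : ∀ t h, (K.facets t ∩ K.holeFacets h).Subsingleton
  /-- no two adjacent facets of a 3-cell are facets of the outside -/
  cell_out : ∀ t, ∀ f ∈ K.facets t, ∀ f' ∈ K.facets t, f ≠ f' →
    (K.sides f ∩ K.sides f').Nonempty → ¬ (f ∈ K.outFacets ∧ f' ∈ K.outFacets)
  /-- every vertex of a 3-cell has degree three in it -/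
  degree_three : ∀ t, ∀ v ∈ K.regionVertices (.cell t),
    {e ∈ K.regionEdges (.cell t) | v ∈ K.ends e}.ncard = 3

namespace Mesh

/-- The vertices of the Euler transformation: a copy of `v` for every region that has `v` as a
vertex. -/
inductive HatV (K : Mesh) : Type
  | copy (v : K.V) (r : K.Region) (h : v ∈ K.regionVertices r)

/-- The edges of the Euler transformation: a copy of `e` for every region that has `e` as an edge,
and for every vertex `v` of a polygon `f` an edge that joins the copies of `v` in the two regions
that meet in `f`. -/
inductive HatE (K : Mesh) : Type
  | copy (e : K.E) (r : K.Region) (h : e ∈ K.regionEdges r)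
  | across (v : K.V) (f : K.F) (h : v ∈ K.corners f)

/-- The polygons of the Euler transformation: a copy of `f` for every region that has `f` as a
facet; for every edge `e` of a polygon `f` a 4-gon spanned by the two copies of `e` on the two sides
of `f`; and for every endpoint `v` of an edge `e` a polygon whose vertices are the copies of `v` in
the regions around `e`. -/
inductive HatF (K : Mesh) : Type
  | copy (f : K.F) (r : K.Region) (h : f ∈ K.regionFacets r)
  | quad (e : K.E) (f : K.F) (h : e ∈ K.sides f)
  | around (v : K.V) (e : K.E) (h : v ∈ K.ends e)

/-- The 3-cells of `K` at the vertex `v`, adjacent when they share a polygon at `v`. -/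
def starGraph (K : Mesh) (v : K.V) :
    SimpleGraph {t : K.T // v ∈ K.regionVertices (.cell t)} where
  Adj t t' := t ≠ t' ∧ ∃ f, f ∈ K.facets t.1 ∧ f ∈ K.facets t'.1 ∧ v ∈ K.corners f
  symm := ⟨fun _ _ ⟨h, f, h₁, h₂, h₃⟩ => ⟨h.symm, f, h₂, h₁, h₃⟩⟩
  loopless := ⟨fun _ h => h.1 rfl⟩

/-- The 3-cells of the Euler transformation, in four classes: one for every 3-cell, polygon and edge
of `K`, and one for every vertex of `K`. At an articulation vertex, where the 3-cells of `K` fall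
into several components under adjacency, there is one 3-cell for each of these components. -/
inductive HatT (K : Mesh) : Type
  | ofSolid (t : K.T)
  | ofPolygon (f : K.F)
  | ofEdge (e : K.E)
  | ofVertex (v : K.V) (c : (K.starGraph v).ConnectedComponent)

/-- The Euler transformation of the complex, every cell being given by its facets. -/
def eulerTransform (K : Mesh) : AbstractComplex where
  V := K.HatV
  E := K.HatE
  F := K.HatF
  T := K.HatT
  ends
    | .copy e r _ => {w | ∃ v h, v ∈ K.ends e ∧ w = .copy v r h}
    | .across v f _ => {w | ∃ r h, f ∈ K.regionFacets r ∧ w = .copy v r h}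
  sides
    | .copy f r _ => {a | ∃ e h, e ∈ K.sides f ∧ a = .copy e r h}
    | .quad e f _ => {a | (∃ r h, f ∈ K.regionFacets r ∧ a = .copy e r h) ∨
        ∃ v h, v ∈ K.ends e ∧ a = .across v f h}
    | .around v e _ => {a | ∃ f h, e ∈ K.sides f ∧ a = .across v f h}
  facets
    | .ofSolid t => {p | ∃ f h, p = .copy f (.cell t) h}
    | .ofPolygon f => {p | (∃ r h, p = .copy f r h) ∨ ∃ e h, p = .quad e f h}
    | .ofEdge e => {p | (∃ f h, p = .quad e f h) ∨ ∃ v h, p = .around v e h}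
    | .ofVertex v c => {p | ∃ e h, p = .around v e h ∧
        ∃ t ∈ c.supp, e ∈ K.regionEdges (.cell t.1)}

end Mesh

namespace Realization

/-- The vertices (0-cells) of the slice of a complex by `P`: the points where `P` meets edges. -/
def sliceVertices {X : AbstractComplex} (R : Realization X) (P : AffineSubspace ℝ E3) : Set E3 :=
  {x | x ∈ P ∧ ∃ e, x ∈ R.body (.edge e)}

/-- The edges (1-cells) of the slice of a complex by `P`: the connected components of the
intersections of `P` with the polygons. -/
def sliceEdges {X : AbstractComplex} (R : Realization X) (P : AffineSubspace ℝ E3) :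
    Set (Set E3) :=
  {A | ∃ f, ∃ x ∈ (P : Set E3) ∩ R.body (.polygon f),
    A = connectedComponentIn ((P : Set E3) ∩ R.body (.polygon f)) x}

/-- The 1-skeleton of the slice as a graph. -/
def sliceGraph {X : AbstractComplex} (R : Realization X) (P : AffineSubspace ℝ E3) :
    SimpleGraph (R.sliceVertices P) where
  Adj x y := x ≠ y ∧ ∃ A ∈ R.sliceEdges P, x.1 ∈ A ∧ y.1 ∈ A
  symm := ⟨fun _ _ ⟨h, A, hA, hx, hy⟩ => ⟨h.symm, A, hA, hy, hx⟩⟩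
  loopless := ⟨fun _ h => h.1 rfl⟩

end Realization

/-- Every connected component of the graph has an Eulerian circuit: from every vertex there is a
closed walk that uses every edge of the component of that vertex exactly once. -/
def HasEulerCircuits {W : Type} (G : SimpleGraph W) : Prop :=
  ∀ x, ∃ p : G.Walk x x, p.IsTrail ∧
    ∀ y z, G.Adj y z → G.Reachable x y → s(y, z) ∈ p.edges

namespace SimpleGraph

/-- A trail that contains every edge at one of its endpoints, where the degree is even, is closed. -/
theorem Walk.IsTrail.eq_of_even_degree {W : Type*} [Fintype W] [DecidableEq W] {G : SimpleGraph W}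
    [DecidableRel G.Adj] {u v : W} {p : G.Walk u v} (hp : p.IsTrail) (heven : Even (G.degree v))
    (hall : ∀ w, G.Adj v w → s(v, w) ∈ p.edges) : u = v := by
  by_contra hne
  have hcount : p.edges.countP (fun e => v ∈ e) = G.degree v := by
    rw [← card_incidenceFinset_eq_degree, List.countP_eq_length_filter,
      ← List.toFinset_card_of_nodup (hp.edges_nodup.filter _)]
    congr 1
    ext e
    simp only [List.mem_toFinset, List.mem_filter, decide_eq_true_eq, mem_incidenceFinset]
    constructor
    · rintro ⟨he, hv⟩
      exact ⟨p.edges_subset_edgeSet he, hv⟩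
    · rintro ⟨he, hv⟩
      obtain ⟨w, rfl⟩ := hv
      exact ⟨hall w he, by simp⟩
  have := (hp.even_countP_edges_iff v).1 (hcount ▸ heven) hne
  exact this.2 rfl

/-- In a finite graph with even degrees every component has an Eulerian circuit. -/
theorem hasEulerCircuits_of_even {W : Type} [Finite W] (G : SimpleGraph W)
    (heven : ∀ v, Even (G.neighborSet v).ncard) : HasEulerCircuits G := by
  classical
  have := Fintype.ofFinite W
  intro x
  let lengths : Set ℕ := {n | ∃ u v, ∃ p : G.Walk u v, G.Reachable x u ∧ p.IsTrail ∧ p.length = n}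
  have hne : lengths.Nonempty := ⟨0, x, x, Walk.nil, Reachable.refl x, Walk.IsTrail.nil, rfl⟩
  have hbdd : BddAbove lengths := by
    refine ⟨G.edgeFinset.card, ?_⟩
    rintro n ⟨u, v, p, -, hp, rfl⟩
    exact hp.length_le_card_edgeFinset
  obtain ⟨u, v, p, hxu, hp, hlen⟩ := Nat.sSup_mem hne hbdd
  have hmax : ∀ {a b : W} (q : G.Walk a b), G.Reachable x a → q.IsTrail → q.length ≤ p.length :=
    fun q ha hq => hlen ▸ le_csSup hbdd ⟨_, _, q, ha, hq, rfl⟩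
  have hxv : G.Reachable x v := hxu.trans ⟨p⟩
  have hextend : ∀ {a b : W} (q : G.Walk a b), G.Reachable x a → q.IsTrail →
      q.length = p.length → ∀ w, G.Adj a w → s(a, w) ∈ q.edges := by
    intro a b q ha hq hl w haw
    by_contra hw
    have := hmax (Walk.cons haw.symm q) (ha.trans haw.reachable)
      ((Walk.isTrail_cons _ _).2 ⟨hq, by rwa [Sym2.eq_swap]⟩)
    simp only [Walk.length_cons] at this
    lia
  have huv : u = v := by
    refine hp.eq_of_even_degree ?_ fun w hw => ?_
    · have := heven v
      rwa [Set.ncard_eq_toFinset_card', ← neighborFinset, card_neighborFinset_eq_degree] at this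
    · simpa using hextend p.reverse hxv hp.reverse (by simp) w hw
  subst huv
  have hedge : ∀ y ∈ p.support, ∀ z, G.Adj y z → s(y, z) ∈ p.edges := by
    intro y hy z hyz
    have := hextend (p.rotate y hy) (hxu.trans ⟨p.takeUntil y hy⟩) (hp.rotate hy)
      (by simp) z hyz
    exact (p.rotate_edges y hy).mem_iff.1 this
  have hsupp : ∀ y, G.Reachable u y → y ∈ p.support := by
    intro y hy
    rw [reachable_iff_reflTransGen] at hy
    induction hy with
    | refl => exact p.start_mem_support
    | tail _ hbc ih => exact p.snd_mem_support_of_mem_edges (hedge _ ih _ hbc)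
  refine ⟨p.rotate x (hsupp x hxu.symm), hp.rotate _, fun y z hyz hxy => ?_⟩
  rw [(p.rotate_edges _ _).mem_iff]
  exact hedge y (hsupp y (hxu.symm.trans hxy)) z hyz

/-- A finite connected graph whose degrees are one or two, and not all two, is a path: it has
exactly two vertices of degree one. -/
theorem Connected.card_degree_eq_one {W : Type*} [Fintype W] {G : SimpleGraph W}
    [DecidableRel G.Adj] (hG : G.Connected) (hdeg : ∀ v, G.degree v = 1 ∨ G.degree v = 2)
    (hone : ∃ v, G.degree v = 1) : (Finset.univ.filter fun v => G.degree v = 1).card = 2 := by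
  classical
  have hsum := G.sum_degrees_eq_twice_card_edges
  have hvert := hG.card_vert_le_card_edgeSet_add_one
  rw [Nat.card_eq_fintype_card, Nat.card_eq_fintype_card, ← edgeFinset_card] at hvert
  have htotal : ∑ v, G.degree v + (Finset.univ.filter fun v => G.degree v = 1).card =
      2 * Fintype.card W := by
    rw [Finset.card_filter, ← Finset.sum_add_distrib, ← Finset.card_univ, mul_comm,
      ← smul_eq_mul, ← Finset.sum_const]
    refine Finset.sum_congr rfl fun v _ => ?_
    rcases hdeg v with h | h <;> simp [h]
  have hpos : 0 < (Finset.univ.filter fun v => G.degree v = 1).card := by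
    obtain ⟨v, hv⟩ := hone
    exact Finset.card_pos.2 ⟨v, by simpa using hv⟩
  lia

/-- In a finite graph whose degrees are one or two, the component of a vertex of degree one has
exactly two vertices of degree one. -/
theorem ncard_reachable_neighborSet_ncard_eq_one {W : Type*} [Finite W] (G : SimpleGraph W)
    (hdeg : ∀ v, (G.neighborSet v).ncard = 1 ∨ (G.neighborSet v).ncard = 2) (x : W)
    (hx : (G.neighborSet x).ncard = 1) :
    {y | G.Reachable x y ∧ (G.neighborSet y).ncard = 1}.ncard = 2 := by
  classical
  let C := G.connectedComponentMk x
  have : Fintype C := Fintype.ofFinite _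
  have hmem : ∀ y, y ∈ C.supp ↔ G.Reachable x y := fun y => by
    rw [ConnectedComponent.mem_supp_iff, ConnectedComponent.eq]
    exact ⟨fun h => h.symm, fun h => h.symm⟩
  have hdegC : ∀ v : C, C.toSimpleGraph.degree v = (G.neighborSet v.1).ncard := by
    intro v
    rw [← card_neighborFinset_eq_degree, neighborFinset, ← Set.ncard_eq_toFinset_card']
    have : G.neighborSet v.1 = Subtype.val '' C.toSimpleGraph.neighborSet v := by
      ext w
      constructor
      · intro hw
        have hwC : w ∈ C.supp := (hmem w).2 (((hmem v.1).1 v.2).trans (Adj.reachable hw))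
        exact ⟨⟨w, hwC⟩, hw, rfl⟩
      · rintro ⟨w, hw, rfl⟩
        exact hw
    rw [this, Set.ncard_image_of_injective _ Subtype.val_injective]
  have h := C.connected_toSimpleGraph.card_degree_eq_one (fun v => by rw [hdegC]; exact hdeg v)
    ⟨⟨x, (hmem x).2 (Reachable.refl x)⟩, by rw [hdegC]; exact hx⟩
  rw [← h, ← Set.ncard_coe_finset, ← Set.ncard_image_of_injective _ Subtype.val_injective]
  congr 1
  ext y
  simp only [Set.mem_ofPred_eq, Finset.coe_filter, Finset.mem_univ, true_and, Set.mem_image]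
  constructor
  · rintro ⟨hy, h1⟩
    exact ⟨⟨y, (hmem y).2 hy⟩, by rw [hdegC]; exact h1, rfl⟩
  · rintro ⟨y, hy, rfl⟩
    rw [hdegC] at hy
    exact ⟨(hmem _).1 y.2, hy⟩

end SimpleGraph

/-- Two distinct pairs in a triple cover it. -/
theorem Finset.union_eq_of_card_eq_two {α : Type*} [DecidableEq α] {s s' t : Finset α}
    (hs : s.card = 2) (hs' : s'.card = 2) (hne : s ≠ s') (hst : s ⊆ t) (hst' : s' ⊆ t)
    (ht : t.card ≤ 3) : s ∪ s' = t := by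
  refine Finset.eq_of_subset_of_card_le (Finset.union_subset hst hst') ?_
  by_contra! h
  have h1 : s = s ∪ s' := Finset.eq_of_subset_of_card_le Finset.subset_union_left (by lia)
  have h2 : s' = s ∪ s' := Finset.eq_of_subset_of_card_le Finset.subset_union_right (by lia)
  exact hne (h1.trans h2.symm)

section Crossing

variable {E : Type*} [AddCommGroup E] [Module ℝ E]

/-- An affine function with a zero in the convex hull of a set on which it does not vanish has
both signs on the set. -/
theorem AffineMap.exists_neg_pos_of_mem_convexHull {g : E →ᵃ[ℝ] ℝ} {s : Set E} {x : E}
    (hs : ∀ v ∈ s, g v ≠ 0) (hx : x ∈ convexHull ℝ s) (hgx : g x = 0) :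
    ∃ a ∈ s, ∃ b ∈ s, g a < 0 ∧ 0 < g b := by
  have hneg : ∃ a ∈ s, g a < 0 := by
    by_contra! h
    have hsub : convexHull ℝ s ⊆ g ⁻¹' Set.Ioi 0 :=
      convexHull_min (fun v hv => lt_of_le_of_ne (h v hv) (hs v hv).symm)
        ((convex_Ioi 0).affine_preimage g)
    exact (hsub hx).ne' hgx
  have hpos : ∃ b ∈ s, 0 < g b := by
    by_contra! h
    have hsub : convexHull ℝ s ⊆ g ⁻¹' Set.Iio 0 :=
      convexHull_min (fun v hv => lt_of_le_of_ne (h v hv) (hs v hv))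
        ((convex_Iio 0).affine_preimage g)
    exact (hsub hx).ne hgx
  obtain ⟨a, ha, hga⟩ := hneg
  obtain ⟨b, hb, hgb⟩ := hpos
  exact ⟨a, ha, b, hb, hga, hgb⟩

/-- An affine function of opposite signs at two points vanishes on the segment between them. -/
theorem AffineMap.exists_eq_zero_of_neg_of_pos {g : E →ᵃ[ℝ] ℝ} {a b : E} (ha : g a < 0)
    (hb : 0 < g b) : ∃ x ∈ convexHull ℝ {a, b}, g x = 0 := by
  have hd : 0 < g b - g a := by linarith
  refine ⟨AffineMap.lineMap a b (-g a / (g b - g a)), ?_, ?_⟩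
  · rw [convexHull_pair, segment_eq_image_lineMap]
    refine ⟨_, ⟨div_nonneg (by linarith) hd.le, ?_⟩, rfl⟩
    rw [div_le_one hd]
    linarith
  · rw [AffineMap.apply_lineMap, AffineMap.lineMap_apply_ring']
    field_simp
    ring

/-- An affine function that does not vanish identically on a segment has at most one zero on it. -/
theorem AffineMap.eq_of_mem_convexHull_pair {g : E →ᵃ[ℝ] ℝ} {a b x y : E} (hab : g a ≠ g b)
    (hx : x ∈ convexHull ℝ {a, b}) (hy : y ∈ convexHull ℝ {a, b}) (hxy : g x = g y) : x = y := by
  rw [convexHull_pair, segment_eq_image_lineMap] at hx hy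
  obtain ⟨t, -, rfl⟩ := hx
  obtain ⟨u, -, rfl⟩ := hy
  rw [AffineMap.apply_lineMap, AffineMap.apply_lineMap, AffineMap.lineMap_apply_ring',
    AffineMap.lineMap_apply_ring'] at hxy
  have : t = u := by
    have h := sub_ne_zero.2 hab.symm
    exact mul_right_cancel₀ h (by linarith)
  rw [this]

end Crossing

namespace Geometry.SimplicialComplex

section Crossing

variable {E : Type*} [AddCommGroup E] [Module ℝ E]

/-- The edges of a simplicial complex on whose endpoints `g` has opposite signs. -/
def crossedEdges (S : SimplicialComplex ℝ E) (g : E →ᵃ[ℝ] ℝ) : Set (Finset E) :=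
  {s ∈ S.faces | ∃ a b, g a < 0 ∧ 0 < g b ∧ (s : Set E) = {a, b}}

open Classical in
/-- The crossed edges of a complex, adjacent when they lie in a common face. -/
def crossingGraph (S : SimplicialComplex ℝ E) (g : E →ᵃ[ℝ] ℝ) :
    SimpleGraph (S.crossedEdges g) where
  Adj s s' := s ≠ s' ∧ s.1 ∪ s'.1 ∈ S.faces
  symm := ⟨fun _ _ ⟨h, h'⟩ => ⟨h.symm, by rwa [Finset.union_comm]⟩⟩
  loopless := ⟨fun _ h => h.1 rfl⟩

variable {S : SimplicialComplex ℝ E} {g : E →ᵃ[ℝ] ℝ}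

theorem card_of_mem_crossedEdges {s : Finset E} (hs : s ∈ S.crossedEdges g) : s.card = 2 := by
  obtain ⟨-, a, b, ha, hb, hs⟩ := hs
  rw [← Set.ncard_coe_finset, hs, Set.ncard_pair]
  rintro rfl
  exact lt_asymm ha hb

theorem mem_crossedEdges_of_mem_convexHull {s : Finset E} {x : E} (hs : s ∈ S.faces)
    (hcard : s.card = 2) (hg : ∀ v ∈ s, g v ≠ 0) (hx : x ∈ convexHull ℝ (s : Set E))
    (hgx : g x = 0) : s ∈ S.crossedEdges g := by
  classical
  obtain ⟨a, ha, b, hb, hga, hgb⟩ := AffineMap.exists_neg_pos_of_mem_convexHull hg hx hgx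
  refine ⟨hs, a, b, hga, hgb, ?_⟩
  have hab : a ≠ b := by
    rintro rfl
    exact lt_asymm hga hgb
  have : ({a, b} : Finset E) = s :=
    Finset.eq_of_subset_of_card_le (by grind) (by rw [hcard, Finset.card_pair hab])
  rw [← this, Finset.coe_pair]

theorem exists_mem_convexHull_of_mem_crossedEdges {s : Finset E} (hs : s ∈ S.crossedEdges g) :
    ∃ x ∈ convexHull ℝ (s : Set E), g x = 0 := by
  obtain ⟨-, a, b, ha, hb, hs⟩ := hs
  rw [hs]
  exact AffineMap.exists_eq_zero_of_neg_of_pos ha hb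

theorem eq_of_mem_convexHull_of_mem_crossedEdges {s : Finset E} (hs : s ∈ S.crossedEdges g)
    {x y : E} (hx : x ∈ convexHull ℝ (s : Set E)) (hy : y ∈ convexHull ℝ (s : Set E))
    (hgx : g x = 0) (hgy : g y = 0) : x = y := by
  obtain ⟨-, a, b, ha, hb, hs⟩ := hs
  rw [hs] at hx hy
  exact AffineMap.eq_of_mem_convexHull_pair (ha.trans hb).ne hx hy (hgx.trans hgy.symm)

theorem exists_crossedEdges_subset {t : Finset E} {x : E} (ht : t ∈ S.faces)
    (hg : ∀ v ∈ t, g v ≠ 0) (hx : x ∈ convexHull ℝ (t : Set E)) (hgx : g x = 0) :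
    ∃ s ∈ S.crossedEdges g, s ⊆ t := by
  classical
  obtain ⟨a, ha, b, hb, hga, hgb⟩ := AffineMap.exists_neg_pos_of_mem_convexHull hg hx hgx
  have hsub : ({a, b} : Finset E) ⊆ t := by
    intro v hv
    rcases Finset.mem_insert.1 hv with rfl | hv
    · exact ha
    · rw [Finset.mem_singleton.1 hv]
      exact hb
  exact ⟨{a, b}, ⟨S.down_closed ht hsub (by simp), a, b, hga, hgb, by simp⟩, hsub⟩

/-- A triangle with one crossed edge has exactly one other crossed edge. -/
theorem existsUnique_crossedEdges {s t : Finset E} (hs : s ∈ S.crossedEdges g) (ht : t ∈ S.faces)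
    (hcard : t.card = 3) (hst : s ⊆ t) (hg : ∀ v ∈ t, g v ≠ 0) :
    ∃! s', s' ∈ S.crossedEdges g ∧ s' ⊆ t ∧ s' ≠ s := by
  classical
  have hs2 := card_of_mem_crossedEdges hs
  obtain ⟨hsS, a, b, ha, hb, hsab⟩ := hs
  have hab : s = {a, b} := by
    apply Finset.coe_injective
    simpa using hsab
  subst hab
  obtain ⟨c, hc⟩ : ∃ c, t \ {a, b} = {c} := by
    rw [← Finset.card_eq_one, Finset.card_sdiff_of_subset hst, hcard, hs2]
  have hct : c ∈ t ∧ c ≠ a ∧ c ≠ b := by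
    have : c ∈ t \ {a, b} := by rw [hc]; simp
    simpa using this
  have ht' : ∀ v, v ∈ t → v = a ∨ v = b ∨ v = c := by
    intro v hv
    by_contra! h
    have : v ∈ t \ {a, b} := by simp [hv, h.1, h.2.1]
    rw [hc] at this
    exact h.2.2 (by simpa using this)
  have hat : a ∈ t := hst (by simp)
  have hbt : b ∈ t := hst (by simp)
  have hpair : ∀ {p q : E}, p ∈ t → q ∈ t → ({p, q} : Finset E) ∈ S.faces := fun hp hq =>
    S.down_closed ht (by grind) (by simp)
  have hform : ∀ s' ∈ S.crossedEdges g, s' ⊆ t → ∃ p ∈ t, ∃ q ∈ t, g p < 0 ∧ 0 < g q ∧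
      s' = {p, q} := by
    rintro s' ⟨-, p, q, hp, hq, hpq⟩ hsub
    have h' : s' = {p, q} := by
      apply Finset.coe_injective
      simpa using hpq
    subst h'
    exact ⟨p, hsub (by simp), q, hsub (by simp), hp, hq, rfl⟩
  rcases lt_or_gt_of_ne (hg c hct.1) with hgc | hgc
  · refine ⟨{c, b}, ⟨⟨hpair hct.1 hbt, c, b, hgc, hb, by simp⟩, by grind, ?_⟩, ?_⟩
    · intro h
      have : a ∈ ({c, b} : Finset E) := by rw [h]; simp
      grind
    · rintro s' ⟨hs', hsub, hne⟩
      obtain ⟨p, hp, q, hq, hgp, hgq, rfl⟩ := hform s' hs' hsub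
      have hqb : q = b := by rcases ht' q hq with rfl | rfl | rfl <;> first | rfl | linarith
      subst hqb
      rcases ht' p hp with rfl | rfl | rfl
      · exact absurd rfl hne
      · linarith
      · rfl
  · refine ⟨{a, c}, ⟨⟨hpair hat hct.1, a, c, ha, hgc, by simp⟩, by grind, ?_⟩, ?_⟩
    · intro h
      have : b ∈ ({a, c} : Finset E) := by rw [h]; simp
      grind
    · rintro s' ⟨hs', hsub, hne⟩
      obtain ⟨p, hp, q, hq, hgp, hgq, rfl⟩ := hform s' hs' hsub
      have hpa : p = a := by rcases ht' p hp with rfl | rfl | rfl <;> first | rfl | linarith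
      subst hpa
      rcases ht' q hq with rfl | rfl | rfl
      · linarith
      · exact absurd rfl hne
      · rfl

theorem card_union_of_adj (hpure : ∀ s ∈ S.faces, ∃ t ∈ S.faces, s ⊆ t ∧ t.card = 3)
    [DecidableEq E] {s s' : S.crossedEdges g} (hne : s ≠ s') (h : s.1 ∪ s'.1 ∈ S.faces) :
    (s.1 ∪ s'.1).card = 3 := by
  obtain ⟨t, -, hst, ht⟩ := hpure _ h
  rw [Finset.union_eq_of_card_eq_two (card_of_mem_crossedEdges s.2) (card_of_mem_crossedEdges s'.2)
    (fun h => hne (Subtype.ext h)) (Finset.subset_union_left.trans hst)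
    (Finset.subset_union_right.trans hst) ht.le, ht]

/-- The degree of a crossed edge in the crossing graph is the number of triangles at it. -/
theorem ncard_neighborSet_crossingGraph
    (hpure : ∀ s ∈ S.faces, ∃ t ∈ S.faces, s ⊆ t ∧ t.card = 3)
    (hg : ∀ s ∈ S.faces, ∀ v ∈ s, g v ≠ 0) (s : S.crossedEdges g) :
    ((S.crossingGraph g).neighborSet s).ncard =
      {t ∈ S.faces | t.card = 3 ∧ s.1 ⊆ t}.ncard := by
  classical
  have himage : {t ∈ S.faces | t.card = 3 ∧ s.1 ⊆ t} =
      (fun s' : S.crossedEdges g => s.1 ∪ s'.1) '' (S.crossingGraph g).neighborSet s := by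
    ext t
    constructor
    · rintro ⟨ht, hcard, hst⟩
      obtain ⟨s', ⟨hs', hsub, hne⟩, -⟩ := existsUnique_crossedEdges s.2 ht hcard hst (hg t ht)
      have hu : s.1 ∪ s' = t := Finset.union_eq_of_card_eq_two (card_of_mem_crossedEdges s.2)
        (card_of_mem_crossedEdges hs') hne.symm hst hsub hcard.le
      refine ⟨⟨s', hs'⟩, ⟨fun h => hne (congrArg Subtype.val h).symm, ?_⟩, hu⟩
      convert ht
    · rintro ⟨s', ⟨hne, hface⟩, rfl⟩
      have hface' : s.1 ∪ s'.1 ∈ S.faces := by convert hface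
      exact ⟨hface', card_union_of_adj hpure hne hface', Finset.subset_union_left⟩
  rw [himage, Set.InjOn.ncard_image]
  rintro s₁ ⟨hne₁, hface₁⟩ s₂ ⟨hne₂, hface₂⟩ heq
  have hface : s.1 ∪ s₁.1 ∈ S.faces := by convert hface₁
  obtain ⟨_, -, huniq⟩ := existsUnique_crossedEdges s.2 hface
    (card_union_of_adj hpure hne₁ hface) Finset.subset_union_left (hg _ hface)
  have h₁ := huniq s₁.1 ⟨s₁.2, Finset.subset_union_right, fun h => hne₁ (Subtype.ext h.symm)⟩
  have heq' : s.1 ∪ s₁.1 = s.1 ∪ s₂.1 := heq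
  have h₂ := huniq s₂.1 ⟨s₂.2, heq' ▸ Finset.subset_union_right,
    fun h => hne₂ (Subtype.ext h.symm)⟩
  exact Subtype.ext (h₁.trans h₂.symm)

/-- Crossed edges in a common triangle are connected in the crossing graph. -/
theorem reachable_of_subset {s s' : S.crossedEdges g} {t : Finset E} (ht : t ∈ S.faces)
    (hst : s.1 ⊆ t) (hst' : s'.1 ⊆ t) : (S.crossingGraph g).Reachable s s' := by
  classical
  by_cases hne : s = s'
  · rw [hne]
  · refine SimpleGraph.Adj.reachable ⟨hne, ?_⟩
    refine S.down_closed ht (Finset.union_subset hst hst') ?_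
    exact (S.nonempty_of_mem_faces s.2.1).mono Finset.subset_union_left

end Crossing

variable {E : Type*} [NormedAddCommGroup E] [NormedSpace ℝ E]
  {S : SimplicialComplex ℝ E} {g : E →ᵃ[ℝ] ℝ}

/-- Two crossed edges are connected in the crossing graph if and only if their zeros of `g` lie in
the same component of the zero set of `g` in the complex. -/
theorem mem_connectedComponentIn_iff_reachable (hgc : Continuous g) (hfin : S.faces.Finite)
    (hpure : ∀ s ∈ S.faces, ∃ t ∈ S.faces, s ⊆ t ∧ t.card = 3)
    (hg : ∀ s ∈ S.faces, ∀ v ∈ s, g v ≠ 0) (s s' : S.crossedEdges g) {x y : E}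
    (hx : x ∈ convexHull ℝ (s.1 : Set E)) (hgx : g x = 0)
    (hy : y ∈ convexHull ℝ (s'.1 : Set E)) (hgy : g y = 0) :
    y ∈ connectedComponentIn ({z | g z = 0} ∩ S.space) x ↔
      (S.crossingGraph g).Reachable s s' := by
  classical
  constructor
  · intro hcomp
    by_contra hreach
    let near : Set (Finset E) := {t ∈ S.faces | t.card = 3 ∧
      ∃ r : S.crossedEdges g, (S.crossingGraph g).Reachable s r ∧ r.1 ⊆ t}
    let far : Set (Finset E) := {t ∈ S.faces | t.card = 3 ∧
      ∀ r : S.crossedEdges g, r.1 ⊆ t → ¬ (S.crossingGraph g).Reachable s r}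
    have hclosed : ∀ C ⊆ S.faces,
        IsClosed (⋃ t ∈ C, {z | g z = 0} ∩ convexHull ℝ (t : Set E)) := by
      intro C hC
      refine (hfin.subset hC).isClosed_biUnion fun t _ => ?_
      exact (isClosed_singleton.preimage hgc).inter (t.finite_toSet.isClosed_convexHull ℝ)
    have hcover : connectedComponentIn ({z | g z = 0} ∩ S.space) x ⊆
        (⋃ t ∈ near, {z | g z = 0} ∩ convexHull ℝ (t : Set E)) ∪
          ⋃ t ∈ far, {z | g z = 0} ∩ convexHull ℝ (t : Set E) := by
      intro z hz
      obtain ⟨hgz, hzS⟩ := connectedComponentIn_subset _ _ hz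
      obtain ⟨u, hu, hzu⟩ := mem_space_iff.1 hzS
      obtain ⟨t, ht, hut, htc⟩ := hpure u hu
      have hzt : z ∈ {z | g z = 0} ∩ convexHull ℝ (t : Set E) :=
        ⟨hgz, convexHull_mono (Finset.coe_subset.2 hut) hzu⟩
      by_cases h : ∃ r : S.crossedEdges g, (S.crossingGraph g).Reachable s r ∧ r.1 ⊆ t
      · exact Or.inl (Set.mem_biUnion (x := t) ⟨ht, htc, h⟩ hzt)
      · push Not at h
        exact Or.inr (Set.mem_biUnion (x := t) ⟨ht, htc, fun r hr hr' => h r hr' hr⟩ hzt)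
    obtain ⟨t, ht, hst, htc⟩ := hpure s.1 s.2.1
    obtain ⟨t', ht', hst', htc'⟩ := hpure s'.1 s'.2.1
    have hxF : x ∈ {z | g z = 0} ∩ S.space := ⟨hgx, convexHull_subset_space s.2.1 hx⟩
    have hmeet := isPreconnected_closed_iff.1
      (isPreconnected_connectedComponentIn (x := x) (F := {z | g z = 0} ∩ S.space)) _ _
      (hclosed near fun _ h => h.1) (hclosed far fun _ h => h.1) hcover
      ⟨x, mem_connectedComponentIn hxF, Set.mem_biUnion (x := t)
        ⟨ht, htc, s, SimpleGraph.Reachable.refl _, hst⟩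
        ⟨hgx, convexHull_mono (Finset.coe_subset.2 hst) hx⟩⟩
      ⟨y, hcomp, Set.mem_biUnion (x := t')
        ⟨ht', htc', fun r hr hr' => hreach (hr'.trans (reachable_of_subset ht' hr hst'))⟩
        ⟨hgy, convexHull_mono (Finset.coe_subset.2 hst') hy⟩⟩
    obtain ⟨z, -, hznear, hzfar⟩ := hmeet
    simp only [Set.mem_iUnion] at hznear hzfar
    obtain ⟨u, ⟨hu, huc, r, hr, hru⟩, hgz, hzu⟩ := hznear
    obtain ⟨u', ⟨hu', huc', hfar⟩, -, hzu'⟩ := hzfar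
    have hz := S.inter_subset_convexHull hu hu' ⟨hzu, hzu'⟩
    rw [← Finset.coe_inter] at hz
    have hne : (u ∩ u').Nonempty := by
      rw [← Finset.coe_nonempty, ← convexHull_nonempty_iff (𝕜 := ℝ)]
      exact ⟨z, hz⟩
    have hface : u ∩ u' ∈ S.faces := S.down_closed hu Finset.inter_subset_left hne
    obtain ⟨q, hq, hqsub⟩ := exists_crossedEdges_subset hface (hg _ hface) hz hgz
    exact hfar ⟨q, hq⟩ (hqsub.trans Finset.inter_subset_right)
      (hr.trans (reachable_of_subset hu hru (hqsub.trans Finset.inter_subset_left)))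
  · intro hreach
    rw [SimpleGraph.reachable_iff_reflTransGen] at hreach
    induction hreach generalizing y with
    | refl =>
      rw [eq_of_mem_convexHull_of_mem_crossedEdges s.2 hy hx hgy hgx]
      exact mem_connectedComponentIn ⟨hgx, convexHull_subset_space s.2.1 hx⟩
    | @tail b c _ hbc ih =>
      obtain ⟨z, hz, hgz⟩ := exists_mem_convexHull_of_mem_crossedEdges b.2
      rw [connectedComponentIn_eq (ih hz hgz)]
      obtain ⟨-, hface⟩ := hbc
      have hconv : Convex ℝ ({z | g z = 0} ∩ convexHull ℝ ((b.1 ∪ c.1 : Finset E) : Set E)) :=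
        ((convex_singleton (0 : ℝ)).affine_preimage g).inter (convex_convexHull ℝ _)
      refine hconv.isPreconnected.subset_connectedComponentIn ⟨hgz, ?_⟩ ?_ ⟨hgy, ?_⟩
      · exact convexHull_mono (Finset.coe_subset.2 Finset.subset_union_left) hz
      · refine Set.inter_subset_inter_right _ (convexHull_subset_space ?_)
        convert hface
      · exact convexHull_mono (Finset.coe_subset.2 Finset.subset_union_right) hy

/-- The zero set of an affine function on a triangulated surface, the function being nonzero at the
vertices of the triangulation: a component that meets the boundary `B` meets it in two points. -/
theorem ncard_connectedComponentIn_inter_boundary (hgc : Continuous g) (hfin : S.faces.Finite)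
    (hpure : ∀ s ∈ S.faces, ∃ t ∈ S.faces, s ⊆ t ∧ t.card = 3)
    (hg : ∀ s ∈ S.faces, ∀ v ∈ s, g v ≠ 0) (B : Set (Finset E))
    (hB : ∀ s ∈ S.faces, s.card = 2 → s ∈ B → {t ∈ S.faces | t.card = 3 ∧ s ⊆ t}.ncard = 1)
    (hinner : ∀ s ∈ S.faces, s.card = 2 → s ∉ B →
      {t ∈ S.faces | t.card = 3 ∧ s ⊆ t}.ncard = 2)
    {s : Finset E} (hs : s ∈ S.faces) (hcard : s.card = 2) (hsB : s ∈ B) {x : E}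
    (hx : x ∈ convexHull ℝ (s : Set E)) (hgx : g x = 0) :
    {y ∈ connectedComponentIn ({z | g z = 0} ∩ S.space) x |
      ∃ s' ∈ S.faces, s'.card = 2 ∧ s' ∈ B ∧ y ∈ convexHull ℝ (s' : Set E)}.ncard = 2 := by
  have hfinite : Finite (S.crossedEdges g) := (hfin.subset fun _ h => h.1).to_subtype
  have hdegB : ∀ r : S.crossedEdges g, ((S.crossingGraph g).neighborSet r).ncard = 1 ↔ r.1 ∈ B := by
    intro r
    rw [ncard_neighborSet_crossingGraph hpure hg]
    constructor
    · intro h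
      by_contra hr
      rw [hinner _ r.2.1 (card_of_mem_crossedEdges r.2) hr] at h
      lia
    · exact hB _ r.2.1 (card_of_mem_crossedEdges r.2)
  have hdeg : ∀ r : S.crossedEdges g, ((S.crossingGraph g).neighborSet r).ncard = 1 ∨
      ((S.crossingGraph g).neighborSet r).ncard = 2 := by
    intro r
    by_cases hr : r.1 ∈ B
    · exact Or.inl ((hdegB r).2 hr)
    · right
      rw [ncard_neighborSet_crossingGraph hpure hg]
      exact hinner _ r.2.1 (card_of_mem_crossedEdges r.2) hr
  let s₀ : S.crossedEdges g := ⟨s, mem_crossedEdges_of_mem_convexHull hs hcard (hg s hs) hx hgx⟩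
  choose zero hzero hgzero using
    fun r : S.crossedEdges g => exists_mem_convexHull_of_mem_crossedEdges r.2
  refine Eq.trans ?_ (SimpleGraph.ncard_reachable_neighborSet_ncard_eq_one (S.crossingGraph g) hdeg
    s₀ ((hdegB s₀).2 hsB))
  have hinj : Function.Injective zero := by
    classical
    intro r r' hrr
    have hmem : zero r ∈ convexHull ℝ ((r.1 ∩ r'.1 : Finset E) : Set E) := by
      rw [Finset.coe_inter]
      exact S.inter_subset_convexHull r.2.1 r'.2.1 ⟨hzero r, hrr ▸ hzero r'⟩
    have hne : (r.1 ∩ r'.1).Nonempty := by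
      rw [← Finset.coe_nonempty, ← convexHull_nonempty_iff (𝕜 := ℝ)]
      exact ⟨_, hmem⟩
    have hface := S.down_closed r.2.1 Finset.inter_subset_left hne
    obtain ⟨q, hq, hsub⟩ := exists_crossedEdges_subset hface (hg _ hface) hmem (hgzero r)
    have hq2 := card_of_mem_crossedEdges hq
    have h₁ : q = r.1 := Finset.eq_of_subset_of_card_le (hsub.trans Finset.inter_subset_left)
      (by rw [hq2, card_of_mem_crossedEdges r.2])
    have h₂ : q = r'.1 := Finset.eq_of_subset_of_card_le (hsub.trans Finset.inter_subset_right)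
      (by rw [hq2, card_of_mem_crossedEdges r'.2])
    exact Subtype.ext (h₁.symm.trans h₂)
  rw [← Set.ncard_image_of_injective _ hinj]
  congr 1
  ext y
  constructor
  · rintro ⟨hy, s', hs', hcard', hsB', hys'⟩
    have hgy : g y = 0 := (connectedComponentIn_subset _ _ hy).1
    have hcross := mem_crossedEdges_of_mem_convexHull hs' hcard' (hg s' hs') hys' hgy
    refine ⟨⟨s', hcross⟩, ⟨?_, (hdegB _).2 hsB'⟩, ?_⟩
    · exact (mem_connectedComponentIn_iff_reachable hgc hfin hpure hg s₀ ⟨s', hcross⟩ hx hgx hys'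
        hgy).1 hy
    · exact eq_of_mem_convexHull_of_mem_crossedEdges hcross (hzero ⟨s', hcross⟩) hys'
        (hgzero _) hgy
  · rintro ⟨r, ⟨hr, hdr⟩, rfl⟩
    exact ⟨(mem_connectedComponentIn_iff_reachable hgc hfin hpure hg s₀ r hx hgx (hzero r)
      (hgzero r)).2 hr, r.1, r.2.1, card_of_mem_crossedEdges r.2, (hdegB r).1 hdr, hzero r⟩

end Geometry.SimplicialComplex

namespace AbstractComplex

variable {X : AbstractComplex}

theorem isFace_vertex_iff {b : X.Cell} {v : X.V} : X.IsFace b (.vertex v) ↔ b = .vertex v := by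
  rw [IsFace, Relation.ReflTransGen.cases_tail_iff]
  constructor
  · rintro (h | ⟨c, -, ⟨⟩⟩)
    exact h.symm
  · exact fun h => Or.inl h.symm

theorem isFace_edge_iff {b : X.Cell} {e : X.E} :
    X.IsFace b (.edge e) ↔ b = .edge e ∨ ∃ v ∈ X.ends e, b = .vertex v := by
  rw [IsFace, Relation.ReflTransGen.cases_tail_iff]
  constructor
  · rintro (h | ⟨c, hbc, hc⟩)
    · exact Or.inl h.symm
    · cases hc with
      | vertex_edge hv => exact Or.inr ⟨_, hv, isFace_vertex_iff.1 hbc⟩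
  · rintro (h | ⟨v, hv, h⟩)
    · exact Or.inl h.symm
    · exact Or.inr ⟨_, isFace_vertex_iff.2 h, .vertex_edge hv⟩

theorem isFace_polygon_iff {b : X.Cell} {f : X.F} :
    X.IsFace b (.polygon f) ↔ b = .polygon f ∨ ∃ e ∈ X.sides f, X.IsFace b (.edge e) := by
  rw [IsFace, Relation.ReflTransGen.cases_tail_iff]
  constructor
  · rintro (h | ⟨c, hbc, hc⟩)
    · exact Or.inl h.symm
    · cases hc with
      | edge_polygon he => exact Or.inr ⟨_, he, hbc⟩
  · rintro (h | ⟨e, he, h⟩)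
    · exact Or.inl h.symm
    · exact Or.inr ⟨_, h, .edge_polygon he⟩

theorem isFace_solid_iff {b : X.Cell} {t : X.T} :
    X.IsFace b (.solid t) ↔ b = .solid t ∨ ∃ f ∈ X.facets t, X.IsFace b (.polygon f) := by
  rw [IsFace, Relation.ReflTransGen.cases_tail_iff]
  constructor
  · rintro (h | ⟨c, hbc, hc⟩)
    · exact Or.inl h.symm
    · cases hc with
      | polygon_solid hf => exact Or.inr ⟨_, hf, hbc⟩
  · rintro (h | ⟨f, hf, h⟩)
    · exact Or.inl h.symm
    · exact Or.inr ⟨_, h, .polygon_solid hf⟩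

end AbstractComplex

namespace Realization

variable {X : AbstractComplex} (R : Realization X)

theorem body_edge_subset_of_isFace {b : X.Cell} {e : X.E} (h : X.IsFace b (.edge e)) :
    R.body b ⊆ R.body (.edge e) := by
  rcases AbstractComplex.isFace_edge_iff.1 h with rfl | ⟨v, hv, rfl⟩
  · exact subset_rfl
  · rintro _ rfl
    exact subset_convexHull ℝ _ ⟨v, hv, rfl⟩

theorem body_side_subset {e : X.E} {f : X.F} (he : e ∈ X.sides f) :
    R.body (.edge e) ⊆ R.body (.polygon f) := by
  obtain ⟨s, hs, hse⟩ := R.side_mem f e he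
  intro x hx
  refine Geometry.SimplicialComplex.convexHull_subset_space hs ?_
  rw [hse]
  exact hx

theorem body_polygon_subset_of_isFace {b : X.Cell} {f : X.F} (h : X.IsFace b (.polygon f)) :
    R.body b ⊆ R.body (.polygon f) := by
  rcases AbstractComplex.isFace_polygon_iff.1 h with rfl | ⟨e, he, hb⟩
  · exact subset_rfl
  · exact (R.body_edge_subset_of_isFace hb).trans (R.body_side_subset he)

theorem isClosed_disc (f : X.F) : IsClosed (R.disc f).space :=
  (R.disc_finite f).isClosed_biUnion fun t _ => t.finite_toSet.isClosed_convexHull ℝ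

/-- Two distinct polygons meet only in sides. -/
theorem exists_common_side {f f' : X.F} (hne : f ≠ f') {x : E3}
    (hx : x ∈ R.body (.polygon f)) (hx' : x ∈ R.body (.polygon f')) :
    ∃ e ∈ X.sides f, R.body (.polygon f) ∩ R.body (.polygon f') ⊆ R.body (.edge e) := by
  obtain ⟨b, hb, hb', hbody⟩ := R.inter_face (.polygon f) (.polygon f') ⟨x, hx, hx'⟩
  rcases AbstractComplex.isFace_polygon_iff.1 hb with rfl | ⟨e, he, hbe⟩
  · rcases AbstractComplex.isFace_polygon_iff.1 hb' with h | ⟨e, he, hbe⟩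
    · cases h
      exact absurd rfl hne
    · rcases AbstractComplex.isFace_edge_iff.1 hbe with h | ⟨v, -, h⟩ <;> cases h
  · exact ⟨e, he, hbody ▸ R.body_edge_subset_of_isFace hbe⟩

theorem disjoint_interior_solidBody {t t' : X.T} (hne : t ≠ t') :
    Disjoint (interior (R.solidBody t)) (interior (R.solidBody t')) := by
  rw [Set.disjoint_left]
  intro x hx hx'
  obtain ⟨b, hb, hb', hbody⟩ := R.inter_face (.solid t) (.solid t')
    ⟨x, interior_subset hx, interior_subset hx'⟩
  rcases AbstractComplex.isFace_solid_iff.1 hb with rfl | ⟨f, hf, hbf⟩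
  · rcases AbstractComplex.isFace_solid_iff.1 hb' with h | ⟨f, hf, hbf⟩
    · cases h
      exact hne rfl
    · rcases AbstractComplex.isFace_polygon_iff.1 hbf with h | ⟨e, -, h⟩
      · cases h
      · rcases AbstractComplex.isFace_edge_iff.1 h with h | ⟨v, -, h⟩ <;> cases h
  · have hxb : x ∈ R.body b := by
      rw [hbody]
      exact ⟨interior_subset hx, interior_subset hx'⟩
    have hfr : x ∈ frontier (R.solidBody t) := by
      rw [R.solid_frontier]
      exact Set.mem_biUnion hf (R.body_polygon_subset_of_isFace hbf hxb)
    exact hfr.2 hx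

end Realization

/-- Every simplex of a simplicial complex has a point that lies in no other simplex, except those
that contain the whole simplex. -/
theorem Geometry.SimplicialComplex.exists_mem_convexHull_forall_subset {E : Type*} [AddCommGroup E]
    [Module ℝ E] (S : Geometry.SimplicialComplex ℝ E) {t : Finset E} (ht : t ∈ S.faces) :
    ∃ x ∈ convexHull ℝ (t : Set E), ∀ s ∈ S.faces, x ∈ convexHull ℝ (s : Set E) → t ⊆ s := by
  classical
  have hcard : (t.card : ℝ) ≠ 0 := by
    exact_mod_cast (Finset.card_pos.2 (S.nonempty_of_mem_faces ht)).ne'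
  refine ⟨∑ y ∈ t, (t.card : ℝ)⁻¹ • y, ?_, fun s hs hx => ?_⟩
  · exact Finset.mem_convexHull'.2 ⟨fun _ => (t.card : ℝ)⁻¹, fun _ _ => by positivity,
      by simp [hcard], rfl⟩
  · have hx' := S.inter_subset_convexHull ht hs ⟨Finset.mem_convexHull'.2
      ⟨fun _ => (t.card : ℝ)⁻¹, fun _ _ => by positivity, by simp [hcard], rfl⟩, hx⟩
    rw [← Finset.coe_inter, Finset.mem_convexHull'] at hx'
    obtain ⟨w, -, hw1, hwx⟩ := hx'
    let w' : E → ℝ := fun y => (if y ∈ s then w y else 0) - (t.card : ℝ)⁻¹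
    have hsum : ∑ y ∈ t, w' y = 0 := by
      simp only [w', Finset.sum_sub_distrib, Finset.sum_const, nsmul_eq_mul,
        mul_inv_cancel₀ hcard, ← Finset.sum_filter, Finset.filter_mem_eq_inter, hw1, sub_self]
    have hcomb : ∑ y ∈ t, w' y • y = 0 := by
      simp only [w', sub_smul, ite_smul, zero_smul, Finset.sum_sub_distrib, ← Finset.sum_filter,
        Finset.filter_mem_eq_inter, hwx, sub_self]
    intro v hv
    by_contra hvs
    have h0 := affineIndependent_iff.1 (S.indep ht) Finset.univ (fun y => w' y.1)
      (by rw [← hsum]; exact Finset.sum_coe_sort t w')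
      (by rw [← hcomb]; exact Finset.sum_coe_sort t fun y => w' y • y) ⟨v, hv⟩ (Finset.mem_univ _)
    simp only [w', hvs, if_false, zero_sub, neg_eq_zero, inv_eq_zero] at h0
    exact hcard h0

section Sectors

/-- A preconnected set that meets the interior of a set and misses its frontier lies in the
interior. -/
theorem IsPreconnected.subset_interior_of_disjoint_frontier {α : Type*} [TopologicalSpace α]
    {s u : Set α} (hs : IsPreconnected s) (hfr : Disjoint s (frontier u))
    (hne : (s ∩ interior u).Nonempty) : s ⊆ interior u := by
  refine hs.subset_left_of_subset_union isOpen_interior isClosed_closure.isOpen_compl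
    (Set.disjoint_compl_right_iff_subset.2 (interior_subset.trans subset_closure)) ?_ hne
  intro x hx
  by_cases h : x ∈ interior u
  · exact Or.inl h
  · exact Or.inr fun hc => Set.disjoint_left.1 hfr hx ⟨hc, h⟩

variable {E : Type*} [NormedAddCommGroup E] [InnerProductSpace ℝ E]

theorem exists_mem_inner_ne_of_isOpen {U : Set E} (hU : IsOpen U) (hne : U.Nonempty) {n : E}
    (hn : n ≠ 0) (c : ℝ) : ∃ y ∈ U, inner ℝ n y ≠ c := by
  obtain ⟨y, hy⟩ := hne
  by_cases hyc : inner ℝ n y = c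
  · have hcont : Continuous fun δ : ℝ => y + δ • n := by fun_prop
    have hmem : ∀ᶠ δ : ℝ in nhdsWithin 0 {0}ᶜ, y + δ • n ∈ U :=
      (hcont.continuousAt.eventually (hU.mem_nhds (by simpa using hy))).filter_mono
        nhdsWithin_le_nhds
    obtain ⟨δ, hδ, hδ0⟩ := (hmem.and self_mem_nhdsWithin).exists
    refine ⟨_, hδ, ?_⟩
    rw [inner_add_right, inner_smul_right, hyc]
    have : δ * inner ℝ n n ≠ 0 := mul_ne_zero hδ0 (by simpa using hn)
    simpa using this
  · exact ⟨y, hy, hyc⟩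

/-- Sets with disjoint interiors, whose frontiers lie near `x` in one hyperplane: at most two of
them are adherent to `x`. -/
theorem not_three_interiors_at_hyperplane {ι : Type*} {B : ι → Set E} {D : Set E} {n x : E} {c : ℝ}
    (hdisj : Pairwise fun i j => Disjoint (interior (B i)) (interior (B j)))
    (hD : IsClosed D) (hxD : x ∉ D) (hn : n ≠ 0)
    (hfr : ∀ i, frontier (B i) ⊆ {y | inner ℝ n y = c} ∪ D) {i j k : ι}
    (hi : x ∈ closure (interior (B i))) (hj : x ∈ closure (interior (B j)))
    (hk : x ∈ closure (interior (B k))) : i = j ∨ i = k ∨ j = k := by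
  obtain ⟨ε, hε, hball⟩ := Metric.isOpen_iff.1 hD.isOpen_compl x hxD
  let H : Bool → Set E := fun σ =>
    Metric.ball x ε ∩ {y | bif σ then c < inner ℝ n y else inner ℝ n y < c}
  have hconv : ∀ σ, Convex ℝ (H σ) := by
    rintro (_ | _)
    · exact (convex_ball x ε).inter (convex_halfSpace_lt (innerₗ E n).isLinear c)
    · exact (convex_ball x ε).inter (convex_halfSpace_gt (innerₗ E n).isLinear c)
  have hHfr : ∀ σ l, Disjoint (H σ) (frontier (B l)) := by
    intro σ l
    rw [Set.disjoint_left]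
    rintro y ⟨hy, hσ⟩ hyfr
    rcases hfr l hyfr with h | h
    · have h' : inner ℝ n y = c := h
      cases σ <;> simp [h'] at hσ
    · exact hball hy h
  have hside : ∀ l, x ∈ closure (interior (B l)) →
      ∃ σ, (H σ).Nonempty ∧ H σ ⊆ interior (B l) := by
    intro l hl
    obtain ⟨y, ⟨hyball, hyint⟩, hyc⟩ := exists_mem_inner_ne_of_isOpen
      (Metric.isOpen_ball.inter isOpen_interior)
      (mem_closure_iff.1 hl _ Metric.isOpen_ball (Metric.mem_ball_self hε)) hn c
    have hmem : ∃ σ, y ∈ H σ := by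
      rcases lt_or_gt_of_ne hyc with h | h
      · exact ⟨false, hyball, h⟩
      · exact ⟨true, hyball, h⟩
    obtain ⟨σ, hσ⟩ := hmem
    exact ⟨σ, ⟨y, hσ⟩, (hconv σ).isPreconnected.subset_interior_of_disjoint_frontier (hHfr σ l)
      ⟨y, hσ, hyint⟩⟩
  have heq : ∀ {l m σ}, (H σ).Nonempty → H σ ⊆ interior (B l) → H σ ⊆ interior (B m) → l = m := by
    rintro l m σ ⟨y, hy⟩ hl hm
    by_contra hne
    exact Set.disjoint_left.1 (hdisj hne) (hl hy) (hm hy)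
  obtain ⟨σi, hnei, hσi⟩ := hside i hi
  obtain ⟨σj, hnej, hσj⟩ := hside j hj
  obtain ⟨σk, hnek, hσk⟩ := hside k hk
  by_cases h₁ : σi = σj
  · exact Or.inl (heq hnei hσi (h₁ ▸ hσj))
  by_cases h₂ : σi = σk
  · exact Or.inr (Or.inl (heq hnei hσi (h₂ ▸ hσk)))
  · have h₃ : σj = σk := by cases σi <;> cases σj <;> cases σk <;> simp_all
    exact Or.inr (Or.inr (heq hnej hσj (h₃ ▸ hσk)))

end Sectors

/-- A coplanar set in 3-space lies in a plane with a normal vector. -/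
theorem Coplanar.exists_inner_eq {A : Set E3} (hA : Coplanar ℝ A) :
    ∃ n : E3, n ≠ 0 ∧ ∃ c, ∀ y ∈ A, inner ℝ n y = c := by
  have hfin : Module.finrank ℝ (vectorSpan ℝ A) ≤ 2 := by
    have h : Module.rank ℝ (vectorSpan ℝ A) ≤ 2 := hA
    exact Module.finrank_le_of_rank_le (by exact_mod_cast h)
  have hne : (vectorSpan ℝ A)ᗮ ≠ ⊥ := by
    rw [Ne, Submodule.orthogonal_eq_bot_iff]
    intro h
    rw [h, finrank_top, finrank_euclideanSpace_fin] at hfin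
    lia
  obtain ⟨n, hn, hn0⟩ := Submodule.exists_mem_ne_zero_of_ne_bot hne
  refine ⟨n, hn0, ?_⟩
  rcases A.eq_empty_or_nonempty with rfl | ⟨p, hp⟩
  · exact ⟨0, by simp⟩
  · refine ⟨inner ℝ n p, fun y hy => ?_⟩
    have := (Submodule.mem_orthogonal' _ _).1 hn _ (vsub_mem_vectorSpan ℝ hy hp)
    rw [vsub_eq_sub, inner_sub_right] at this
    linarith

namespace InputMesh

variable {K : Mesh}

/-- The point set of a region. -/
def regionBody (M : InputMesh K) : K.Region → Set E3
  | .cell t => M.solidBody t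
  | .hole h => M.holeBody h
  | .outside => M.outBody

theorem frontier_regionBody (M : InputMesh K) (r : K.Region) :
    frontier (M.regionBody r) = ⋃ f ∈ K.regionFacets r, (M.disc f).space := by
  cases r with
  | cell t => exact M.solid_frontier t
  | hole h => exact M.hole_frontier h
  | outside => exact M.out_frontier

theorem closure_interior_regionBody (M : InputMesh K) (r : K.Region) :
    closure (interior (M.regionBody r)) = M.regionBody r := by
  cases r with
  | cell t => exact M.solid_regular t
  | hole h => exact M.hole_regular h
  | outside => exact M.out_regular

theorem disjoint_interior_regionBody (M : InputMesh K) :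
    Pairwise fun r r' => Disjoint (interior (M.regionBody r)) (interior (M.regionBody r')) := by
  have hspace : ∀ t, interior (M.solidBody t) ⊆ M.toCellBodies.space := fun t =>
    interior_subset.trans (Set.subset_iUnion M.toCellBodies.body (.solid t))
  rintro (t | h | _) (t' | h' | _) hne
  · exact M.disjoint_interior_solidBody fun h => hne (congrArg _ h)
  · exact ((M.hole_disjoint h').mono_right (hspace t)).symm
  · exact (M.out_disjoint.mono_right (hspace t)).symm
  · exact (M.hole_disjoint h).mono_right (hspace t')
  · exact (M.holes_disjoint fun e => hne (congrArg _ e)).mono interior_subset interior_subset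
  · exact (M.hole_out_disjoint h).mono interior_subset interior_subset
  · exact M.out_disjoint.mono_right (hspace t')
  · exact (M.hole_out_disjoint h').symm.mono interior_subset interior_subset
  · exact absurd rfl hne

/-- At most two regions share a polygon. -/
theorem not_three_regions (M : InputMesh K) {f : K.F} {r₁ r₂ r₃ : K.Region} (h₁ : f ∈ K.regionFacets r₁)
    (h₂ : f ∈ K.regionFacets r₂) (h₃ : f ∈ K.regionFacets r₃) :
    r₁ = r₂ ∨ r₁ = r₃ ∨ r₂ = r₃ := by
  have := M.finite_F
  obtain ⟨φ⟩ := M.disc_homeo f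
  obtain ⟨s, hs, -⟩ := Geometry.SimplicialComplex.mem_space_iff.1
    (φ.symm ⟨0, Metric.mem_closedBall_self zero_le_one⟩).2
  obtain ⟨t, ht, -, htc⟩ := M.disc_pure f s hs
  obtain ⟨x, hxt, hx⟩ := (M.disc f).exists_mem_convexHull_forall_subset ht
  have hxf : x ∈ (M.disc f).space := Geometry.SimplicialComplex.convexHull_subset_space ht hxt
  have hother : ∀ f', f ≠ f' → x ∉ (M.disc f').space := by
    intro f' hne hxf'
    obtain ⟨e, he, hsub⟩ := M.exists_common_side hne hxf hxf'
    obtain ⟨u, hu, hue⟩ := M.side_mem f e he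
    have hxu : x ∈ convexHull ℝ (u : Set E3) := by
      rw [hue]
      exact hsub ⟨hxf, hxf'⟩
    have hle := Finset.card_le_card (hx u hu hxu)
    have hucard : u.card ≤ 2 := by
      rw [← Set.ncard_coe_finset, hue, ← M.ends_two e]
      exact Set.ncard_image_le (Set.finite_of_ncard_ne_zero (by rw [M.ends_two e]; lia))
    lia
  obtain ⟨n, hn, c, hc⟩ := (M.planar f).exists_inner_eq
  have hclosure : ∀ r, f ∈ K.regionFacets r → x ∈ closure (interior (M.regionBody r)) := by
    intro r hr
    have hmem : x ∈ frontier (M.regionBody r) := by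
      rw [M.frontier_regionBody]
      exact Set.mem_biUnion hr hxf
    have := frontier_subset_closure hmem
    rwa [← M.closure_interior_regionBody r, closure_closure] at this
  refine not_three_interiors_at_hyperplane (B := M.regionBody)
    (D := ⋃ f' ∈ {f' | f ≠ f'}, (M.disc f').space) M.disjoint_interior_regionBody
    ((Set.toFinite _).isClosed_biUnion fun f' _ => M.isClosed_disc f') ?_ hn (c := c) ?_
    (hclosure _ h₁) (hclosure _ h₂) (hclosure _ h₃)
  · simp only [Set.mem_iUnion, not_exists]
    exact hother
  · intro r y hy
    rw [M.frontier_regionBody] at hy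
    simp only [Set.mem_iUnion] at hy
    obtain ⟨f', -, hy⟩ := hy
    by_cases h : f = f'
    · exact Or.inl (hc y (h ▸ hy))
    · exact Or.inr (Set.mem_biUnion (x := f') h hy)

end InputMesh

namespace InputMesh

variable {K : Mesh}

/-- An edge of the Euler transformation has at most two ends. -/
theorem not_three_ends_eulerTransform (M : InputMesh K) (a : K.HatE) {w₁ w₂ w₃ : K.HatV}
    (h₁ : w₁ ∈ K.eulerTransform.ends a) (h₂ : w₂ ∈ K.eulerTransform.ends a)
    (h₃ : w₃ ∈ K.eulerTransform.ends a) : w₁ = w₂ ∨ w₁ = w₃ ∨ w₂ = w₃ := by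
  cases a with
  | copy e r he =>
    obtain ⟨v₁, _, hv₁, rfl⟩ := h₁
    obtain ⟨v₂, _, hv₂, rfl⟩ := h₂
    obtain ⟨v₃, _, hv₃, rfl⟩ := h₃
    obtain ⟨p, q, -, hpq⟩ := Set.ncard_eq_two.1 (M.ends_two e)
    rw [hpq] at hv₁ hv₂ hv₃
    simp only [Set.mem_insert_iff, Set.mem_singleton_iff] at hv₁ hv₂ hv₃
    simp only [Mesh.HatV.copy.injEq, and_true]
    grind
  | across v f hv =>
    obtain ⟨r₁, _, hr₁, rfl⟩ := h₁
    obtain ⟨r₂, _, hr₂, rfl⟩ := h₂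
    obtain ⟨r₃, _, hr₃, rfl⟩ := h₃
    simpa using M.not_three_regions hr₁ hr₂ hr₃

/-- An edge of the Euler transformation lies in exactly four polygons. -/
theorem ncard_polygons_eulerTransform (M : InputMesh K) (a : K.HatE) :
    {p : K.HatF | a ∈ K.eulerTransform.sides p}.ncard = 4 := by
  cases a with
  | copy e r he =>
    have hfacets := M.edge_two r e he
    have hcopy : {p : K.HatF | ∃ f h, e ∈ K.sides f ∧ p = .copy f r h}.ncard = 2 := by
      rw [← hfacets]
      refine (Set.ncard_congr (fun f hf => Mesh.HatF.copy f r hf.1) ?_ ?_ ?_).symm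
      · exact fun f hf => ⟨f, hf.1, hf.2, rfl⟩
      · intro f f' _ _ h
        exact (Mesh.HatF.copy.inj h).1
      · rintro _ ⟨f, h, hef, rfl⟩
        exact ⟨f, ⟨h, hef⟩, rfl⟩
    have hquad : {p : K.HatF | ∃ f h, f ∈ K.regionFacets r ∧ p = .quad e f h}.ncard = 2 := by
      rw [← hfacets]
      refine (Set.ncard_congr (fun f hf => Mesh.HatF.quad e f hf.2) ?_ ?_ ?_).symm
      · exact fun f hf => ⟨f, hf.2, hf.1, rfl⟩
      · intro f f' _ _ h
        exact (Mesh.HatF.quad.inj h).2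
      · rintro _ ⟨f, h, hfr, rfl⟩
        exact ⟨f, ⟨hfr, h⟩, rfl⟩
    have hunion : {p : K.HatF | Mesh.HatE.copy e r he ∈ K.eulerTransform.sides p} =
        {p | ∃ f h, e ∈ K.sides f ∧ p = .copy f r h} ∪
          {p | ∃ f h, f ∈ K.regionFacets r ∧ p = .quad e f h} := by
      ext p
      constructor
      · intro hp
        cases p with
        | copy f r' h =>
          obtain ⟨e', _, he', heq⟩ := hp
          obtain ⟨rfl, rfl⟩ := Mesh.HatE.copy.inj heq
          exact Or.inl ⟨f, h, he', rfl⟩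
        | quad e' f h =>
          rcases hp with ⟨r', _, hr', heq⟩ | ⟨_, _, _, heq⟩
          · obtain ⟨rfl, rfl⟩ := Mesh.HatE.copy.inj heq
            exact Or.inr ⟨f, h, hr', rfl⟩
          · cases heq
        | around v e' h =>
          obtain ⟨_, _, _, heq⟩ := hp
          cases heq
      · rintro (⟨f, h, hef, rfl⟩ | ⟨f, h, hfr, rfl⟩)
        · exact ⟨e, he, hef, rfl⟩
        · exact Or.inl ⟨r, he, hfr, rfl⟩
    rw [hunion, Set.ncard_union_eq ?_ (Set.finite_of_ncard_ne_zero (by lia))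
      (Set.finite_of_ncard_ne_zero (by lia)), hcopy, hquad]
    rw [Set.disjoint_left]
    rintro _ ⟨f, h, -, rfl⟩ ⟨f', h', -, heq⟩
    cases heq
  | across v f hv =>
    have hsides := M.corner_two f v hv
    have hquad : {p : K.HatF | ∃ e h, v ∈ K.ends e ∧ p = .quad e f h}.ncard = 2 := by
      rw [← hsides]
      refine (Set.ncard_congr (fun e he => Mesh.HatF.quad e f he.1) ?_ ?_ ?_).symm
      · exact fun e he => ⟨e, he.1, he.2, rfl⟩
      · intro e e' _ _ h
        exact (Mesh.HatF.quad.inj h).1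
      · rintro _ ⟨e, h, hve, rfl⟩
        exact ⟨e, ⟨h, hve⟩, rfl⟩
    have haround : {p : K.HatF | ∃ e h, e ∈ K.sides f ∧ p = .around v e h}.ncard = 2 := by
      rw [← hsides]
      refine (Set.ncard_congr (fun e he => Mesh.HatF.around v e he.2) ?_ ?_ ?_).symm
      · exact fun e he => ⟨e, he.2, he.1, rfl⟩
      · intro e e' _ _ h
        exact (Mesh.HatF.around.inj h).2
      · rintro _ ⟨e, h, hef, rfl⟩
        exact ⟨e, ⟨hef, h⟩, rfl⟩
    have hunion : {p : K.HatF | Mesh.HatE.across v f hv ∈ K.eulerTransform.sides p} =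
        {p | ∃ e h, v ∈ K.ends e ∧ p = .quad e f h} ∪
          {p | ∃ e h, e ∈ K.sides f ∧ p = .around v e h} := by
      ext p
      constructor
      · intro hp
        cases p with
        | copy f' r h =>
          obtain ⟨_, _, _, heq⟩ := hp
          cases heq
        | quad e f' h =>
          rcases hp with ⟨_, _, _, heq⟩ | ⟨v', _, hv', heq⟩
          · cases heq
          · obtain ⟨rfl, rfl⟩ := Mesh.HatE.across.inj heq
            exact Or.inl ⟨e, h, hv', rfl⟩
        | around v' e h =>
          obtain ⟨f', _, hf', heq⟩ := hp
          obtain ⟨rfl, rfl⟩ := Mesh.HatE.across.inj heq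
          exact Or.inr ⟨e, h, hf', rfl⟩
      · rintro (⟨e, h, hve, rfl⟩ | ⟨e, h, hef, rfl⟩)
        · exact Or.inr ⟨v, hv, hve, rfl⟩
        · exact ⟨f, hv, hef, rfl⟩
    rw [hunion, Set.ncard_union_eq ?_ (Set.finite_of_ncard_ne_zero (by lia))
      (Set.finite_of_ncard_ne_zero (by lia)), hquad, haround]
    rw [Set.disjoint_left]
    rintro _ ⟨f, h, -, rfl⟩ ⟨f', h', -, heq⟩
    cases heq

theorem finite_hatE (M : InputMesh K) : Finite K.HatE := by
  have := M.finite_V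
  have := M.finite_E
  have := M.finite_F
  have := M.finite_T
  have := M.finite_Hole
  have hregion : Finite K.Region := by
    refine Finite.of_injective (β := (K.T ⊕ K.Hole) ⊕ Unit)
      (fun | .cell t => .inl (.inl t) | .hole h => .inl (.inr h) | .outside => .inr ()) ?_
    rintro (t | h | _) (t' | h' | _) heq <;> simp_all
  refine Finite.of_injective (β := (K.E × K.Region) ⊕ (K.V × K.F))
    (fun | .copy e r _ => .inl (e, r) | .across v f _ => .inr (v, f)) ?_
  rintro (⟨e, r, _⟩ | ⟨v, f, _⟩) (⟨e', r', _⟩ | ⟨v', f', _⟩) heq <;> simp_all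

end InputMesh

/-- A plane in 3-space is the zero set of an affine function. -/
theorem AffineSubspace.exists_affineMap_eq_zero (P : AffineSubspace ℝ E3)
    (hP : Module.finrank ℝ P.direction = 2) :
    ∃ g : E3 →ᵃ[ℝ] ℝ, (P : Set E3) = {z | g z = 0} := by
  have hne : (P : Set E3).Nonempty := by
    by_contra h
    rw [Set.not_nonempty_iff_eq_empty, AffineSubspace.coe_eq_bot_iff] at h
    rw [h, AffineSubspace.direction_bot, finrank_bot] at hP
    lia
  obtain ⟨p, hp⟩ := hne
  have horth : Module.finrank ℝ P.directionᗮ = 1 := by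
    have := P.direction.finrank_add_finrank_orthogonal
    rw [hP, finrank_euclideanSpace_fin] at this
    exact Nat.add_left_cancel (n := 2) this
  obtain ⟨n, hn, hn0⟩ := Submodule.exists_mem_ne_zero_of_ne_bot
    (p := P.directionᗮ) (fun h => by rw [h, finrank_bot] at horth; lia)
  have hspan : Submodule.span ℝ {n} = P.directionᗮ :=
    Submodule.eq_of_le_of_finrank_eq ((Submodule.span_singleton_le_iff_mem _ _).2 hn)
      (by rw [finrank_span_singleton hn0, horth])
  refine ⟨(innerₗ E3 n).toAffineMap - AffineMap.const ℝ E3 (inner ℝ n p), ?_⟩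
  ext z
  rw [SetLike.mem_coe, ← AffineSubspace.vsub_right_mem_direction_iff_mem hp,
    ← Submodule.orthogonal_orthogonal P.direction, ← hspan,
    Submodule.mem_orthogonal_singleton_iff_inner_right, vsub_eq_sub, inner_sub_right]
  simp

namespace Realization

variable {X : AbstractComplex} (R : Realization X) {g : E3 →ᵃ[ℝ] ℝ}

/-- A cutting function that is nonzero at the vertices of the complex is of opposite signs at the
two ends of an edge on which it vanishes somewhere. -/
theorem exists_ends_eq_pair (hvert : ∀ v, g (R.pos v) ≠ 0) {a : X.E}
    (hends : ∀ w₁ ∈ X.ends a, ∀ w₂ ∈ X.ends a, ∀ w₃ ∈ X.ends a, w₁ = w₂ ∨ w₁ = w₃ ∨ w₂ = w₃)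
    {x : E3} (hx : x ∈ R.body (.edge a)) (hgx : g x = 0) :
    ∃ p q, X.ends a = {p, q} ∧ g (R.pos p) < 0 ∧ 0 < g (R.pos q) := by
  obtain ⟨_, ⟨p, hp, rfl⟩, _, ⟨q, hq, rfl⟩, hgp, hgq⟩ :=
    AffineMap.exists_neg_pos_of_mem_convexHull (s := R.pos '' X.ends a)
      (by rintro _ ⟨v, -, rfl⟩; exact hvert v) hx hgx
  refine ⟨p, q, ?_, hgp, hgq⟩
  have hpq : p ≠ q := by
    rintro rfl
    exact lt_asymm hgp hgq
  ext w
  constructor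
  · intro hw
    rcases hends p hp q hq w hw with h | h | h
    · exact absurd h hpq
    · exact Or.inl h.symm
    · exact Or.inr h.symm
  · rintro (rfl | rfl)
    · exact hp
    · exact hq

theorem eq_of_mem_body_edge (hvert : ∀ v, g (R.pos v) ≠ 0) {a : X.E}
    (hends : ∀ w₁ ∈ X.ends a, ∀ w₂ ∈ X.ends a, ∀ w₃ ∈ X.ends a, w₁ = w₂ ∨ w₁ = w₃ ∨ w₂ = w₃)
    {x y : E3} (hx : x ∈ R.body (.edge a)) (hy : y ∈ R.body (.edge a)) (hgx : g x = 0)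
    (hgy : g y = 0) : x = y := by
  obtain ⟨p, q, hpq, hgp, hgq⟩ := R.exists_ends_eq_pair hvert hends hx hgx
  simp only [CellBodies.body, hpq, Set.image_pair] at hx hy
  exact AffineMap.eq_of_mem_convexHull_pair (hgp.trans hgq).ne hx hy (hgx.trans hgy.symm)

/-- A cell that contains a point of an edge in the cut has the edge as a face. -/
theorem isFace_of_mem_body_edge (hvert : ∀ v, g (R.pos v) ≠ 0) {a : X.E} {c : X.Cell} {x : E3}
    (hx : x ∈ R.body (.edge a)) (hc : x ∈ R.body c) (hgx : g x = 0) : X.IsFace (.edge a) c := by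
  obtain ⟨b, hba, hbc, hbody⟩ := R.inter_face (.edge a) c ⟨x, hx, hc⟩
  rcases AbstractComplex.isFace_edge_iff.1 hba with rfl | ⟨v, -, rfl⟩
  · exact hbc
  · have hxv : x ∈ R.body (.vertex v) := by
      rw [hbody]
      exact ⟨hx, hc⟩
    rw [show x = R.pos v from hxv] at hgx
    exact absurd hgx (hvert v)

theorem mem_sides_of_mem_body (hvert : ∀ v, g (R.pos v) ≠ 0) {a : X.E} {f : X.F} {x : E3}
    (hx : x ∈ R.body (.edge a)) (hf : x ∈ R.body (.polygon f)) (hgx : g x = 0) :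
    a ∈ X.sides f := by
  rcases AbstractComplex.isFace_polygon_iff.1 (R.isFace_of_mem_body_edge hvert hx hf hgx) with
    h | ⟨e, he, hae⟩
  · cases h
  · rcases AbstractComplex.isFace_edge_iff.1 hae with h | ⟨v, -, h⟩ <;> cases h
    exact he

variable {P : AffineSubspace ℝ E3}

/-- A plane that contains no vertex of the complex and no simplex of a non-planar polygon
contains no vertex of the triangulations of the polygons. -/
theorem ne_zero_of_mem_disc (hPg : (P : Set E3) = {z | g z = 0}) (hvert : ∀ v, g (R.pos v) ≠ 0)
    (hsimplex : ∀ f, ¬ Coplanar ℝ (R.body (.polygon f)) →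
      ∀ s ∈ (R.disc f).faces, ¬ convexHull ℝ (s : Set E3) ⊆ (P : Set E3))
    (f : X.F) : ∀ s ∈ (R.disc f).faces, ∀ v ∈ s, g v ≠ 0 := by
  intro s hs v hv hgv
  by_cases hf : Coplanar ℝ (R.body (.polygon f))
  · obtain ⟨w, -, rfl⟩ := R.disc_planar f hf s hs hv
    exact hvert w hgv
  · refine hsimplex f hf {v} ((R.disc f).down_closed hs (by simpa using hv) (by simp)) ?_
    rw [hPg]
    simpa using hgv

/-- The component of the cut of a polygon at a point of one of its sides contains exactly two
vertices of the slice. -/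
theorem ncard_connectedComponentIn_inter_sliceVertices (hPg : (P : Set E3) = {z | g z = 0})
    (hvert : ∀ v, g (R.pos v) ≠ 0)
    (hends : ∀ a, ∀ w₁ ∈ X.ends a, ∀ w₂ ∈ X.ends a, ∀ w₃ ∈ X.ends a,
      w₁ = w₂ ∨ w₁ = w₃ ∨ w₂ = w₃)
    (hsimplex : ∀ f, ¬ Coplanar ℝ (R.body (.polygon f)) →
      ∀ s ∈ (R.disc f).faces, ¬ convexHull ℝ (s : Set E3) ⊆ (P : Set E3))
    {a : X.E} {f : X.F} (haf : a ∈ X.sides f) {x : E3} (hx : x ∈ R.body (.edge a))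
    (hgx : g x = 0) :
    (connectedComponentIn ((P : Set E3) ∩ R.body (.polygon f)) x ∩ R.sliceVertices P).ncard
      = 2 := by
  have hcard : ∀ (a' : X.E) (y : E3), y ∈ R.body (.edge a') → g y = 0 → ∀ s : Finset E3,
      (s : Set E3) = R.pos '' X.ends a' → s.card = 2 := by
    intro a' y hy hgy s hs
    obtain ⟨p, q, hpq, hgp, hgq⟩ := R.exists_ends_eq_pair hvert (hends a') hy hgy
    rw [← Set.ncard_coe_finset, hs, hpq, Set.image_pair, Set.ncard_pair]
    intro h
    rw [h] at hgp
    exact lt_asymm hgp hgq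
  let B : Set (Finset E3) := {s | ∃ e ∈ X.sides f, (s : Set E3) = R.pos '' X.ends e}
  obtain ⟨s, hs, hsa⟩ := R.side_mem f a haf
  have hcount := Geometry.SimplicialComplex.ncard_connectedComponentIn_inter_boundary
    (S := R.disc f) (g := g) g.continuous_of_finiteDimensional (R.disc_finite f) (R.disc_pure f)
    (R.ne_zero_of_mem_disc hPg hvert hsimplex f) B
    (fun s hs _ ⟨e, he, hse⟩ => R.side_boundary f e he s hs hse)
    (fun s hs hc hsB => R.inner_edge f s hs hc fun e he hse => hsB ⟨e, he, hse⟩)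
    hs (hcard a x hx hgx s hsa) ⟨a, haf, hsa⟩ (by rw [hsa]; exact hx) hgx
  rw [← hcount, hPg]
  congr 1
  ext y
  refine and_congr_right fun hy => ?_
  obtain ⟨hgy, hyf⟩ := connectedComponentIn_subset _ _ hy
  constructor
  · rintro ⟨-, a', hya'⟩
    have ha'f := R.mem_sides_of_mem_body hvert hya' hyf hgy
    obtain ⟨s', hs', hsa'⟩ := R.side_mem f a' ha'f
    exact ⟨s', hs', hcard a' y hya' hgy s' hsa', ⟨a', ha'f, hsa'⟩, by rw [hsa']; exact hya'⟩
  · rintro ⟨s', hs', -, ⟨a', ha'f, hsa'⟩, hys'⟩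
    refine ⟨?_, a', ?_⟩
    · rw [← SetLike.mem_coe, hPg]
      exact hgy
    · rw [hsa'] at hys'
      exact hys'

/-- The slice of a complex in which every edge has at most two ends and lies in exactly four
polygons is a graph with all degrees four. -/
theorem slice_four_regular (hP : Module.finrank ℝ P.direction = 2)
    (hcell : ∀ c : X.Cell, ¬ R.body c ⊆ (P : Set E3))
    (hsimplex : ∀ f, ¬ Coplanar ℝ (R.body (.polygon f)) →
      ∀ s ∈ (R.disc f).faces, ¬ convexHull ℝ (s : Set E3) ⊆ (P : Set E3))
    (hfin : Finite X.E)
    (hends : ∀ a, ∀ w₁ ∈ X.ends a, ∀ w₂ ∈ X.ends a, ∀ w₃ ∈ X.ends a,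
      w₁ = w₂ ∨ w₁ = w₃ ∨ w₂ = w₃)
    (hfour : ∀ a, {f | a ∈ X.sides f}.ncard = 4) :
    (∀ A ∈ R.sliceEdges P, (A ∩ R.sliceVertices P).Nonempty →
      (A ∩ R.sliceVertices P).ncard = 2) ∧
    (∀ x ∈ R.sliceVertices P, {A ∈ R.sliceEdges P | x ∈ A}.ncard = 4) ∧
    (∀ x, ((R.sliceGraph P).neighborSet x).ncard = 4) ∧
    HasEulerCircuits (R.sliceGraph P) := by
  obtain ⟨g, hPg⟩ := P.exists_affineMap_eq_zero hP
  have hmemP : ∀ {z}, z ∈ P ↔ g z = 0 := fun {z} => by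
    rw [← SetLike.mem_coe, hPg]
    rfl
  have hvert : ∀ v, g (R.pos v) ≠ 0 := by
    intro v hv
    refine hcell (.vertex v) ?_
    rintro _ rfl
    exact hmemP.2 hv
  have htwo : ∀ {a f x}, a ∈ X.sides f → x ∈ R.body (.edge a) → g x = 0 →
      (connectedComponentIn ((P : Set E3) ∩ R.body (.polygon f)) x ∩ R.sliceVertices P).ncard
        = 2 := fun haf hx hgx =>
    R.ncard_connectedComponentIn_inter_sliceVertices hPg hvert hends hsimplex haf hx hgx
  have hself : ∀ {a f x}, a ∈ X.sides f → x ∈ R.body (.edge a) → g x = 0 →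
      x ∈ connectedComponentIn ((P : Set E3) ∩ R.body (.polygon f)) x := fun haf hx hgx =>
    mem_connectedComponentIn ⟨hmemP.2 hgx, R.body_side_subset haf hx⟩
  have hcommon : ∀ {f f' x y}, x ∈ R.body (.polygon f) → x ∈ R.body (.polygon f') →
      y ∈ R.body (.polygon f) → y ∈ R.body (.polygon f') → g x = 0 → g y = 0 → x ≠ y →
      f = f' := by
    intro f f' x y hx hx' hy hy' hgx hgy hxy
    by_contra hne
    obtain ⟨e, -, hsub⟩ := R.exists_common_side hne hx hx'
    exact hxy (R.eq_of_mem_body_edge hvert (hends e) (hsub ⟨hx, hx'⟩) (hsub ⟨hy, hy'⟩) hgx hgy)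
  have hedge : ∀ {A x}, A ∈ R.sliceEdges P → x ∈ A → ∃ f, x ∈ R.body (.polygon f) ∧
      A = connectedComponentIn ((P : Set E3) ∩ R.body (.polygon f)) x := by
    rintro _ x ⟨f, x₀, hx₀, rfl⟩ hx
    exact ⟨f, (connectedComponentIn_subset _ _ hx).2, connectedComponentIn_eq hx⟩
  have hother : ∀ {a f x}, a ∈ X.sides f → x ∈ R.body (.edge a) → g x = 0 →
      ∃ y, y ≠ x ∧ connectedComponentIn ((P : Set E3) ∩ R.body (.polygon f)) x ∩
        R.sliceVertices P = {x, y} := by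
    intro a f x haf hx hgx
    obtain ⟨p, q, hpq, heq⟩ := Set.ncard_eq_two.1 (htwo haf hx hgx)
    have hxmem : x ∈ ({p, q} : Set E3) := heq ▸ ⟨hself haf hx hgx, hmemP.2 hgx, a, hx⟩
    rcases hxmem with rfl | h
    · exact ⟨q, hpq.symm, heq⟩
    · rw [Set.mem_singleton_iff] at h
      subst h
      exact ⟨p, hpq, by rw [heq, Set.pair_comm]⟩
  have hdegree : ∀ x, ((R.sliceGraph P).neighborSet x).ncard = 4 := by
    rintro ⟨x, hxP, a, hx⟩
    have hgx := hmemP.1 hxP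
    choose y hyx hy using fun f : {f | a ∈ X.sides f} => hother f.2 hx hgx
    have hymem : ∀ f, y f ∈ connectedComponentIn ((P : Set E3) ∩ R.body (.polygon f.1)) x ∩
        R.sliceVertices P := fun f => by
      rw [hy f]
      exact Or.inr rfl
    rw [← hfour a, ← Set.ncard_image_of_injective _ Subtype.val_injective,
      ← Nat.card_coe_set_eq {f | a ∈ X.sides f}, ← Set.ncard_univ,
      ← Set.ncard_image_of_injective (f := y) Set.univ ?_, Set.image_univ]
    · congr 1
      ext z
      constructor
      · rintro ⟨z, ⟨hne, A, hA, hxA, hzA⟩, rfl⟩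
        obtain ⟨f, hxf, rfl⟩ := hedge hA hxA
        have haf := R.mem_sides_of_mem_body hvert hx hxf hgx
        have hz : z.1 ∈ ({x, y ⟨f, haf⟩} : Set E3) := hy ⟨f, haf⟩ ▸ ⟨hzA, z.2⟩
        rcases hz with h | h
        · exact absurd (Subtype.ext h.symm) hne
        · exact ⟨⟨f, haf⟩, h.symm⟩
      · rintro ⟨f, rfl⟩
        refine ⟨⟨y f, (hymem f).2⟩, ⟨fun h => hyx f (congrArg Subtype.val h).symm, _,
          ⟨f.1, x, ⟨hxP, R.body_side_subset f.2 hx⟩, rfl⟩, hself f.2 hx hgx, (hymem f).1⟩, rfl⟩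
    · intro f f' hff
      have hyf := connectedComponentIn_subset _ _ (hymem f).1
      have hyf' := connectedComponentIn_subset _ _ (hymem f').1
      rw [← hff] at hyf'
      exact Subtype.ext (hcommon (R.body_side_subset f.2 hx) (R.body_side_subset f'.2 hx) hyf.2
        hyf'.2 hgx (hmemP.1 hyf.1) (hyx f).symm)
  refine ⟨?_, ?_, hdegree, ?_⟩
  · rintro A hA ⟨x, hxA, hxP, a, hx⟩
    obtain ⟨f, hxf, rfl⟩ := hedge hA hxA
    exact htwo (R.mem_sides_of_mem_body hvert hx hxf (hmemP.1 hxP)) hx (hmemP.1 hxP)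
  · rintro x ⟨hxP, a, hx⟩
    have hgx := hmemP.1 hxP
    have himage : {A ∈ R.sliceEdges P | x ∈ A} =
        (fun f => connectedComponentIn ((P : Set E3) ∩ R.body (.polygon f)) x) ''
          {f | a ∈ X.sides f} := by
      ext A
      constructor
      · rintro ⟨hA, hxA⟩
        obtain ⟨f, hxf, rfl⟩ := hedge hA hxA
        exact ⟨f, R.mem_sides_of_mem_body hvert hx hxf hgx, rfl⟩
      · rintro ⟨f, haf, rfl⟩
        exact ⟨⟨f, x, ⟨hxP, R.body_side_subset haf hx⟩, rfl⟩, hself haf hx hgx⟩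
    rw [himage, Set.InjOn.ncard_image, hfour]
    intro f haf f' haf' heq
    obtain ⟨y, hyx, hy⟩ := hother haf hx hgx
    have hymem : y ∈ connectedComponentIn ((P : Set E3) ∩ R.body (.polygon f)) x ∩
        R.sliceVertices P := by
      rw [hy]
      exact Or.inr rfl
    have hyf := connectedComponentIn_subset _ _ hymem.1
    have hyf' := connectedComponentIn_subset _ _ (heq.subset hymem.1)
    exact hcommon (R.body_side_subset haf hx) (R.body_side_subset haf' hx) hyf.2 hyf'.2 hgx
      (hmemP.1 hyf.1) hyx.symm
  · have hfinite : (R.sliceVertices P).Finite := by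
      refine (Set.finite_iUnion fun a : X.E => Set.Subsingleton.finite
        (s := {x | g x = 0 ∧ x ∈ R.body (.edge a)}) ?_).subset ?_
      · exact fun x hx y hy => R.eq_of_mem_body_edge hvert (hends a) hx.2 hy.2 hx.1 hy.1
      · rintro x ⟨hxP, a, hx⟩
        exact Set.mem_iUnion.2 ⟨a, hmemP.1 hxP, hx⟩
    have := hfinite.to_subtype
    exact SimpleGraph.hasEulerCircuits_of_even _ fun x => by
      rw [hdegree x]
      decide

end Realization

theorem mainTheorem7 (K : Mesh) (M : InputMesh K) (R : Realization K.eulerTransform)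
    (P : AffineSubspace ℝ E3) (hP : Module.finrank ℝ P.direction = 2)
    (hcell : ∀ c : K.eulerTransform.Cell, ¬ R.body c ⊆ (P : Set E3))
    (hsimplex : ∀ f : K.eulerTransform.F, ¬ Coplanar ℝ (R.body (.polygon f)) →
      ∀ s ∈ (R.disc f).faces, ¬ convexHull ℝ (s : Set E3) ⊆ (P : Set E3)) :
    (∀ A ∈ R.sliceEdges P, (A ∩ R.sliceVertices P).Nonempty →
      (A ∩ R.sliceVertices P).ncard = 2) ∧
    (∀ x ∈ R.sliceVertices P, {A ∈ R.sliceEdges P | x ∈ A}.ncard = 4) ∧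
    (∀ x, ((R.sliceGraph P).neighborSet x).ncard = 4) ∧
    HasEulerCircuits (R.sliceGraph P) :=
  R.slice_four_regular hP hcell hsimplex M.finite_hatE
    (fun a _ h₁ _ h₂ _ h₃ => M.not_three_ends_eulerTransform a h₁ h₂ h₃)
    M.ncard_polygons_eulerTransform
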